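/- Let $j\ge 1$ be an integer, $T>0$, $r\in\mathbb R$, $0\le b\le 1$, and $\mathbb T=\mathbb R/2\pi\mathbb Z$. With $\langle x\rangle=(1+x^2)^{1/2}$ and $\widetilde g(\tau,k)$ the space-time Fourier transform, let $X^{s,b}$ be the completion of the Schwartz functions on $\mathbb R\times\mathbb T$ for the norm $$\|g\|_{X^{s,b}}^2=\frac1{2\pi}\sum_{k\in\mathbb Z}\int_{\mathbb R}\langle k\rangle^{2s}\,\langle \tau-k^{2j+1}\rangle^{2b}\,|\widetilde g(\tau,k)|^2\,d\tau ,$$ and let $X_T^{s,b}$ be the space of restrictions of elements of $X^{s,b}$ to $(0,T)\times\mathbb T$. For an open set $\omega\subset\mathbb T$ let $H^s(\omega)$ be the space of restrictions to $\omega$ of elements of $H^s(\mathbb T)$, with the quotient norm. Let $f\in X_T^{r,-b}$, and let $u\in X_T^{r,b}$ satisfy $$\partial_t u+(-1)^{j+1}\partial_x^{2j+1}u=f$$ in the sense of distributions on $(0,T)\times\mathbb T$. Suppose that there are a nonempty open set $\omega\subset\mathbb T$ and a number $\rho$ with $$0<\rho\le\min\left\{j(1-b),\tfrac12\right\}$$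 such that $u\in L^2_{loc}\big((0,T);H^{r+\rho}(\omega)\big)$. Then $u\in L^2_{loc}\big((0,T);H^{r+\rho}(\mathbb T)\big)$. -/

import Mathlib

open MeasureTheory Set

noncomputable section

namespace TorusDispersive

/-! ### Space-time, test functions and distributions -/

/-- The circle `ℝ / 2πℤ`, with its standard measure of total mass `2π`. -/
abbrev Torus : Type := AddCircle (2 * Real.pi)

instance fact_two_pi_pos : Fact (0 < 2 * Real.pi) := ⟨Real.two_pi_pos⟩

/-- The lift of a function on `ℝ × 𝕋` to a function on `ℝ × ℝ`, `2π`-periodic in `x`. -/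
def lift (φ : ℝ × Torus → ℂ) : ℝ × ℝ → ℂ := fun p => φ (p.1, (p.2 : Torus))

/-- The derivative of `φ` in the direction `v = (v_t, v_x)`. -/
def dirDeriv (v : ℝ × ℝ) (φ : ℝ × Torus → ℂ) : ℝ × Torus → ℂ :=
  fun p => deriv (fun h : ℝ => φ (p.1 + h * v.1, p.2 + ((h * v.2 : ℝ) : Torus))) 0

/-- `C_c^∞(Ω)` for `Ω ⊆ ℝ × 𝕋`: the smooth complex functions whose support is a compact
subset of `Ω`. -/
def testFn (Ω : Set (ℝ × Torus)) : Submodule ℂ (ℝ × Torus → ℂ) where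
  carrier := {φ | ContDiff ℝ ((⊤ : ℕ∞) : WithTop ℕ∞) (lift φ) ∧ HasCompactSupport φ ∧ tsupport φ ⊆ Ω}
  zero_mem' := by
    refine ⟨contDiff_const, HasCompactSupport.zero, ?_⟩
    simp [tsupport, Function.support_zero]
  add_mem' := by
    rintro φ ψ ⟨h1, h2, h3⟩ ⟨k1, k2, k3⟩
    exact ⟨h1.add k1, h2.add k2, (tsupport_add φ ψ).trans (union_subset h3 k3)⟩
  smul_mem' := by
    rintro c φ ⟨h1, h2, h3⟩
    exact ⟨contDiff_const.mul h1, h2.smul_left (f := fun _ => c),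
      (closure_mono (Function.support_const_smul_subset c φ)).trans h3⟩

theorem lift_dirDeriv (v : ℝ × ℝ) {φ : ℝ × Torus → ℂ} (h : ContDiff ℝ ((⊤ : ℕ∞) : WithTop ℕ∞) (lift φ)) (p : ℝ × ℝ) :
    lift (dirDeriv v φ) p = fderiv ℝ (lift φ) p v := by
  have hd : DifferentiableAt ℝ (lift φ) p := (h.differentiable (by simp)) p
  have h1 : HasDerivAt (fun s : ℝ => p + s • v) v 0 := by
    simpa using ((hasDerivAt_id (0 : ℝ)).smul_const v).const_add p
  have h2 : HasFDerivAt (lift φ) (fderiv ℝ (lift φ) p) (p + (0 : ℝ) • v) := by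
    simpa using hd.hasFDerivAt
  have h3 := (h2.comp_hasDerivAt (0 : ℝ) h1).deriv
  rw [← h3]
  simp only [lift, dirDeriv]
  congr 1

theorem tsupport_dirDeriv_subset (v : ℝ × ℝ) (φ : ℝ × Torus → ℂ) :
    tsupport (dirDeriv v φ) ⊆ tsupport φ := by
  refine closure_minimal ?_ (isClosed_tsupport φ)
  intro p hp
  by_contra hn
  apply hp
  have h0 : φ =ᶠ[nhds p] 0 := notMem_tsupport_iff_eventuallyEq.1 hn
  have hc : Continuous (fun h : ℝ => (p.1 + h * v.1, p.2 + ((h * v.2 : ℝ) : Torus))) := by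
    have : Continuous (fun h : ℝ => ((h * v.2 : ℝ) : Torus)) :=
      (AddCircle.continuous_mk' (2 * Real.pi)).comp (by fun_prop)
    fun_prop
  have ht := hc.tendsto 0
  simp only [zero_mul, add_zero, QuotientAddGroup.mk_zero] at ht
  have h1 : (fun h : ℝ => φ (p.1 + h * v.1, p.2 + ((h * v.2 : ℝ) : Torus)))
      =ᶠ[nhds 0] fun _ => 0 := ht.eventually h0
  simp only [dirDeriv]
  rw [h1.deriv_eq]
  simp

theorem lift_dirDeriv_eq (v : ℝ × ℝ) {φ : ℝ × Torus → ℂ} (h : ContDiff ℝ ((⊤ : ℕ∞) : WithTop ℕ∞) (lift φ)) :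
    lift (dirDeriv v φ) = (ContinuousLinearMap.apply ℝ ℂ v) ∘ (fderiv ℝ (lift φ)) :=
  funext fun p => lift_dirDeriv v h p

theorem dirDeriv_mem (v : ℝ × ℝ) {Ω : Set (ℝ × Torus)} {φ : ℝ × Torus → ℂ}
    (hφ : φ ∈ testFn Ω) : dirDeriv v φ ∈ testFn Ω := by
  obtain ⟨h1, h2, h3⟩ := hφ
  refine ⟨?_, ?_, (tsupport_dirDeriv_subset v φ).trans h3⟩
  · rw [lift_dirDeriv_eq v h1]
    exact (ContinuousLinearMap.contDiff _).comp (h1.fderiv_right (m := ((⊤ : ℕ∞) : WithTop ℕ∞)) (by simp))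
  · exact h2.of_isClosed_subset (isClosed_tsupport _) (tsupport_dirDeriv_subset v φ)

theorem eq_of_lift_eq {φ ψ : ℝ × Torus → ℂ} (h : lift φ = lift ψ) : φ = ψ := by
  funext ⟨t, x⟩
  obtain ⟨y, rfl⟩ := QuotientAddGroup.mk_surjective x
  exact congrFun h (t, y)

/-- The directional derivative as a linear map on test functions. -/
def testDeriv (v : ℝ × ℝ) (Ω : Set (ℝ × Torus)) : testFn Ω →ₗ[ℂ] testFn Ω where
  toFun φ := ⟨dirDeriv v φ.1, dirDeriv_mem v φ.2⟩
  map_add' φ ψ := by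
    apply Subtype.ext
    apply eq_of_lift_eq
    funext p
    have e : lift ((φ + ψ : testFn Ω) : ℝ × Torus → ℂ) = lift φ.1 + lift ψ.1 := rfl
    have hφ := φ.2.1.differentiable (by simp) p
    have hψ := ψ.2.1.differentiable (by simp) p
    change lift (dirDeriv v (φ + ψ : testFn Ω).1) p
      = lift (dirDeriv v φ.1) p + lift (dirDeriv v ψ.1) p
    rw [lift_dirDeriv v (φ + ψ).2.1, lift_dirDeriv v φ.2.1, lift_dirDeriv v ψ.2.1, e,
      fderiv_add hφ hψ]
    rfl
  map_smul' c φ := by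
    apply Subtype.ext
    apply eq_of_lift_eq
    funext p
    have e : lift ((c • φ : testFn Ω) : ℝ × Torus → ℂ) = c • lift φ.1 := rfl
    have hφ := φ.2.1.differentiable (by simp) p
    change lift (dirDeriv v (c • φ : testFn Ω).1) p = c • lift (dirDeriv v φ.1) p
    rw [lift_dirDeriv v (c • φ).2.1, lift_dirDeriv v φ.2.1, e, fderiv_const_smul hφ]
    rfl

/-- `D'(Ω)` for an open `Ω ⊆ ℝ × 𝕋`: the linear functionals on `C_c^∞(Ω)` that, on the test
functions supported in any fixed compact `K ⊆ Ω`, are bounded by a constant times a bound for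
finitely many derivatives. -/
def distr (Ω : Set (ℝ × Torus)) : Submodule ℂ (testFn Ω →ₗ[ℂ] ℂ) where
  carrier := {u | ∀ K : Set (ℝ × Torus), IsCompact K → K ⊆ Ω → ∃ (C : ℝ) (N : ℕ),
    ∀ φ : testFn Ω, tsupport φ.1 ⊆ K → ∀ M : ℝ,
      (∀ n ≤ N, ∀ p, ‖iteratedFDeriv ℝ n (lift φ.1) p‖ ≤ M) → ‖u φ‖ ≤ C * M}
  zero_mem' := fun K _ _ => ⟨0, 0, fun φ _ M _ => by simp⟩
  add_mem' := by
    intro u w hu hw K hK hKΩ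
    obtain ⟨C, N, h⟩ := hu K hK hKΩ
    obtain ⟨C', N', h'⟩ := hw K hK hKΩ
    refine ⟨C + C', max N N', fun φ hφ M hM => ?_⟩
    have a := h φ hφ M fun n hn => hM n (hn.trans (le_max_left _ _))
    have b := h' φ hφ M fun n hn => hM n (hn.trans (le_max_right _ _))
    calc ‖(u + w) φ‖ ≤ ‖u φ‖ + ‖w φ‖ := norm_add_le _ _
      _ ≤ (C + C') * M := by linarith
  smul_mem' := by
    intro c u hu K hK hKΩ
    obtain ⟨C, N, h⟩ := hu K hK hKΩ
    refine ⟨‖c‖ * C, N, fun φ hφ M hM => ?_⟩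
    calc ‖(c • u) φ‖ = ‖c‖ * ‖u φ‖ := norm_mul _ _
      _ ≤ ‖c‖ * (C * M) := mul_le_mul_of_nonneg_left (h φ hφ M hM) (norm_nonneg _)
      _ = ‖c‖ * C * M := by ring

/-- The distributional derivative `⟨∂_v u, φ⟩ = -⟨u, ∂_v φ⟩`. -/
def distrDeriv (v : ℝ × ℝ) (Ω : Set (ℝ × Torus)) : distr Ω →ₗ[ℂ] distr Ω where
  toFun u := ⟨-(u.1 ∘ₗ testDeriv v Ω), by
    intro K hK hKΩ
    obtain ⟨C, N, h⟩ := u.2 K hK hKΩ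
    refine ⟨C * ‖ContinuousLinearMap.apply ℝ ℂ v‖, N + 1, fun φ hφ M hM => ?_⟩
    have key := h (testDeriv v Ω φ) ((tsupport_dirDeriv_subset v φ.1).trans hφ)
      (‖ContinuousLinearMap.apply ℝ ℂ v‖ * M) (by
        intro n hn p
        have hsm : ContDiff ℝ ((⊤ : ℕ∞) : WithTop ℕ∞) (fderiv ℝ (lift φ.1)) := φ.2.1.fderiv_right (m := ((⊤ : ℕ∞) : WithTop ℕ∞)) (by simp)
        change ‖iteratedFDeriv ℝ n (lift (dirDeriv v φ.1)) p‖ ≤ _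
        rw [lift_dirDeriv_eq v φ.2.1]
        refine (ContinuousLinearMap.norm_iteratedFDeriv_comp_left _ (N := ((⊤ : ℕ∞) : WithTop ℕ∞)) hsm.contDiffAt
          (by exact_mod_cast le_top)).trans ?_
        rw [norm_iteratedFDeriv_fderiv]
        exact mul_le_mul_of_nonneg_left (hM (n + 1) (by omega) p) (norm_nonneg _))
    change ‖-(u.1 (testDeriv v Ω φ))‖ ≤ _
    rw [norm_neg]
    linarith⟩
  map_add' u w := by
    apply Subtype.ext
    apply LinearMap.ext
    intro φ
    change -(u.1 (testDeriv v Ω φ) + w.1 (testDeriv v Ω φ))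
      = -(u.1 (testDeriv v Ω φ)) + -(w.1 (testDeriv v Ω φ))
    ring
  map_smul' c u := by
    apply Subtype.ext
    apply LinearMap.ext
    intro φ
    change -(c * u.1 (testDeriv v Ω φ)) = c * -(u.1 (testDeriv v Ω φ))
    ring

/-- The linear operator `∂_t + (-1)^(j+1) ∂_x^(2j+1)` on `D'(Ω)`. -/
def kdvOp (j : ℕ) (Ω : Set (ℝ × Torus)) : distr Ω →ₗ[ℂ] distr Ω :=
  distrDeriv (1, 0) Ω + (-1 : ℂ) ^ (j + 1) • distrDeriv (0, 1) Ω ^ (2 * j + 1)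

/-- `u = w` on `W`: the two distributions agree on all test functions supported in `W`. -/
def EqOn {Ω₁ Ω₂ : Set (ℝ × Torus)} (u : distr Ω₁) (w : distr Ω₂) (W : Set (ℝ × Torus)) : Prop :=
  ∀ (φ : ℝ × Torus → ℂ) (h₁ : φ ∈ testFn Ω₁) (h₂ : φ ∈ testFn Ω₂), φ ∈ testFn W →
    u.1 ⟨φ, h₁⟩ = w.1 ⟨φ, h₂⟩

/-! ### The function spaces -/

/-- The bracket `⟨x⟩ = (1 + x²)^(1/2)`. -/
def bracket (x : ℝ) : ℝ := Real.sqrt (1 + x ^ 2)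

/-- The space-time Fourier transform of a function,
`φ~(τ, n) = (2π)⁻¹ ∫_ℝ ∫_𝕋 e^{-ixn} e^{-itτ} φ(t, x) dx dt`. -/
def stFourier (φ : ℝ × Torus → ℂ) (τ : ℝ) (n : ℤ) : ℂ :=
  ((2 * Real.pi : ℝ) : ℂ)⁻¹ * ∫ t : ℝ, ∫ x : Torus,
    fourier (-n) x * Complex.exp (-(Complex.I * (t * τ : ℝ))) * φ (t, x)

/-- The square of the norm of `X^{s,b}`, as a functional of the space-time Fourier transform
`(k, τ) ↦ G k τ`. -/
def xsbNormSq (j : ℕ) (s b : ℝ) (G : ℤ → ℝ → ℂ) : ENNReal :=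
  ENNReal.ofReal (2 * Real.pi)⁻¹ * ∑' k : ℤ, ∫⁻ τ : ℝ, ENNReal.ofReal
    (bracket (k : ℝ) ^ (2 * s) * bracket (τ - (k : ℝ) ^ (2 * j + 1)) ^ (2 * b) * ‖G k τ‖ ^ 2)

/-- The Bourgain space `X^{s,b}`, i.e. the completion of the Schwartz functions on `ℝ × 𝕋` in
the `X^{s,b}` norm, realised as a space of distributions: those `g` whose space-time Fourier
transform is a measurable function `G` with finite norm. That `G` is the Fourier transform of
`g` is expressed by `⟨g, φ⟩ = ∑_k ∫ G(τ, k) φ~(-τ, -k) dτ`. -/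
def Xsb (j : ℕ) (s b : ℝ) : Set (distr (univ : Set (ℝ × Torus))) :=
  {g | ∃ G : ℤ → ℝ → ℂ, (∀ k, AEStronglyMeasurable (G k) volume) ∧ xsbNormSq j s b G < ⊤ ∧
    ∀ φ : testFn (univ : Set (ℝ × Torus)),
      HasSum (fun k : ℤ => ∫ τ : ℝ, G k τ * stFourier φ.1 (-τ) (-k)) (g.1 φ)}

/-- The restriction space `X_I^{s,b}` of distributions on `I × 𝕋`. -/
def XsbOn (j : ℕ) (I : Set ℝ) (s b : ℝ) : Set (distr (I ×ˢ (univ : Set Torus))) :=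
  {u | ∃ g ∈ Xsb j s b, EqOn u g (I ×ˢ univ)}

/-- `L²(I; H^s(𝕋))` for an open interval `I`, as a space of distributions on `I × 𝕋`: those
`v = ∑_k c_k(t) e^{ikx}` with `c_k` measurable and `∫_I ∑_k ⟨k⟩^(2s) |c_k(t)|² dt < ∞`. -/
def L2Hs (I : Set ℝ) (s : ℝ) : Set (distr (I ×ˢ (univ : Set Torus))) :=
  {v | ∃ c : ℤ → ℝ → ℂ, (∀ k, AEStronglyMeasurable (c k) (volume.restrict I)) ∧
    (∫⁻ t in I, ∑' k : ℤ, ENNReal.ofReal (bracket (k : ℝ) ^ (2 * s) * ‖c k t‖ ^ 2)) < ⊤ ∧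
    ∀ φ : testFn (I ×ˢ (univ : Set Torus)),
      HasSum (fun k : ℤ => ∫ t in I, ∫ x : Torus, c k t * fourier k x * φ.1 (t, x)) (v.1 φ)}

/-- `u ∈ L²_loc((0,T); H^s(ω))` for an open `ω ⊆ 𝕋`. Here `H^s(ω)` is the space of restrictions
to `ω` of elements of `H^s(𝕋)`, with the quotient norm. As that is a quotient of a Hilbert space,
an element of `L²((a, b); H^s(ω))` is the restriction to `(a, b) × ω` of an element of
`L²((a, b); H^s(𝕋))`; the condition is imposed on each compact interval `[a, b] ⊂ (0, T)`.
For `ω = 𝕋` it reads `u ∈ L²_loc((0,T); H^s(𝕋))`. -/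
def MemL2locHs (T s : ℝ) (ω : Set Torus) (u : distr (Ioo 0 T ×ˢ (univ : Set Torus))) : Prop :=
  ∀ a b : ℝ, 0 < a → a < b → b < T → ∃ v ∈ L2Hs (Ioo a b) s, EqOn u v (Ioo a b ×ˢ ω)

end TorusDispersive

end

/-!
The proof is an estimate on the Fourier side, uniform in the time frequency `ξ`; it replaces the
usual commutator argument.

For a cutoff `ψ(t)` supported in `(0, T)` let `W_k(ξ) = ⟨u, ψ e^{-itξ} e^{-ikx}⟩` be the transform
of `ψ u`. It is the convolution in `τ` of the transform of `u` with that of `ψ` (`timeConv`), and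
testing the equation gives `i (ξ - k^(2j+1)) W_k = (ψ f)^ + (ψ' u)^` (`kdvOp_tens`). Localisation in
time preserves `X^{r,-b}`, by the inequalities of Peetre and Young (`sqNorm_timeConv_lt_top`), so
that `ψ u` lies in `X^{r,1-b}` (`sqNorm_gain_modulation`).

The powers `k^(2j+1)` are spaced by about `|k|^(2j)`. So for each `ξ` at most one frequency `k` is
*resonant*, that is, within `|k|^(2j) / 2` of `ξ` (`Resonant.unique`). At all other frequencies
`⟨ξ - k^(2j+1)⟩^(1-b)` dominates `⟨k⟩^(2j(1-b))`, hence `⟨k⟩^ρ`, and the nonresonant part of `ψ u`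
is in `L²H^{r+ρ}` (`sqNorm_nonresonant_lt_top`).

The one resonant coefficient is recovered from the information on `ω`. With `χ` a smooth cutoff
supported in `ω` and `X` its Fourier coefficients, the hypothesis gives a family `V` in
`ℓ²L²` with weight `⟨k⟩^(r+ρ)` such that `∑_k X(n-k) W_k(ξ) = ∑_k X(n-k) V_k(ξ)` for all `n`
and `ξ`. If `n` is resonant with `ξ`, all the other `W_k(ξ)` are already controlled, and
`X(0) ≠ 0` allows to solve for `W_n(ξ)` (`wt_mul_enorm_le_controlled`). Young's inequality on `ℤ`
then bounds the whole of `W` (`sqNorm_lt_top_of_local`), and Plancherel's theorem turns the bound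
into `u ∈ L²H^{r+ρ}` where `ψ = 1` (`restrictDistr_mem_L2Hs`).
-/

noncomputable section

namespace TorusDispersive

open scoped ENNReal FourierTransform

/-! ### Weights -/

/-- The weight `⟨x⟩^s`, with values in `[0, ∞]`. -/
def wt (s x : ℝ) : ℝ≥0∞ := ENNReal.ofReal (bracket x ^ s)

theorem one_le_bracket (x : ℝ) : 1 ≤ bracket x := by
  rw [bracket, Real.one_le_sqrt]; nlinarith [sq_nonneg x]

theorem bracket_pos (x : ℝ) : 0 < bracket x := one_pos.trans_le (one_le_bracket x)

theorem bracket_sq (x : ℝ) : bracket x ^ 2 = 1 + x ^ 2 := Real.sq_sqrt (by positivity)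

theorem continuous_bracket : Continuous bracket := by unfold bracket; fun_prop

theorem bracket_le_one_add_abs (x : ℝ) : bracket x ≤ 1 + |x| := by
  refine Real.sqrt_le_iff.2 ⟨by positivity, ?_⟩
  nlinarith [sq_abs x, abs_nonneg x]

theorem measurable_wt (s : ℝ) : Measurable (wt s) := by
  unfold wt
  exact ((continuous_bracket.measurable).pow_const s).ennreal_ofReal

theorem wt_ne_top (s x : ℝ) : wt s x ≠ ⊤ := ENNReal.ofReal_ne_top

theorem wt_ne_zero (s x : ℝ) : wt s x ≠ 0 := by
  have := Real.rpow_pos_of_pos (bracket_pos x) s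
  simpa [wt] using this

theorem wt_add (s t x : ℝ) : wt (s + t) x = wt s x * wt t x := by
  rw [wt, Real.rpow_add (bracket_pos x),
    ENNReal.ofReal_mul (Real.rpow_nonneg (bracket_pos x).le s)]
  rfl

theorem wt_sq (s x : ℝ) : wt s x ^ 2 = wt (2 * s) x := by rw [sq, ← wt_add, two_mul]

theorem wt_mono {s t : ℝ} (h : s ≤ t) (x : ℝ) : wt s x ≤ wt t x :=
  ENNReal.ofReal_le_ofReal (Real.rpow_le_rpow_of_exponent_le (one_le_bracket x) h)

theorem one_le_wt {s : ℝ} (h : 0 ≤ s) (x : ℝ) : 1 ≤ wt s x := by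
  simpa [wt] using wt_mono h x

theorem bracket_add_le (x y : ℝ) : bracket (x + y) ≤ 2 * bracket x * bracket y := by
  refine Real.sqrt_le_iff.2 ⟨by have := bracket_pos x; have := bracket_pos y; positivity, ?_⟩
  rw [mul_pow, mul_pow, bracket_sq, bracket_sq]
  nlinarith [sq_nonneg (x - y), mul_nonneg (sq_nonneg x) (sq_nonneg y), sq_nonneg x, sq_nonneg y]

/-- Peetre's inequality `⟨x⟩^s ≤ C ⟨x - y⟩^|s| ⟨y⟩^s`, for either sign of `s`. -/
theorem wt_le_peetre (s x y : ℝ) :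
    wt s x ≤ ENNReal.ofReal (2 ^ |s|) * wt |s| (x - y) * wt s y := by
  have hx := bracket_pos x
  have hy := bracket_pos y
  have hd := bracket_pos (x - y)
  unfold wt
  rw [← ENNReal.ofReal_mul (by positivity), ← ENNReal.ofReal_mul (by positivity)]
  apply ENNReal.ofReal_le_ofReal
  rcases le_total 0 s with hs | hs
  · rw [abs_of_nonneg hs, ← Real.mul_rpow (by norm_num) hd.le,
      ← Real.mul_rpow (by positivity) hy.le]
    refine Real.rpow_le_rpow hx.le ?_ hs
    simpa using bracket_add_le (x - y) y
  · rw [abs_of_nonpos hs, ← Real.mul_rpow (by norm_num) hd.le]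
    have h : bracket y ≤ (2 * bracket (x - y)) * bracket x := by
      have := bracket_add_le (y - x) x
      have e : bracket (y - x) = bracket (x - y) := by
        unfold bracket; congr 2; ring
      rw [e] at this
      simpa using this
    have h2 : bracket y ^ (-s) ≤ (2 * bracket (x - y)) ^ (-s) * bracket x ^ (-s) := by
      rw [← Real.mul_rpow (by positivity) hx.le]
      exact Real.rpow_le_rpow hy.le h (by linarith)
    rw [Real.rpow_neg hy.le, Real.rpow_neg hx.le] at h2
    have ha : 0 < bracket x ^ s := Real.rpow_pos_of_pos hx s
    have hb : 0 < bracket y ^ s := Real.rpow_pos_of_pos hy s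
    rw [inv_le_iff_one_le_mul₀ hb] at h2
    calc bracket x ^ s = bracket x ^ s * 1 := (mul_one _).symm
      _ ≤ bracket x ^ s * ((2 * bracket (x - y)) ^ (-s) * (bracket x ^ s)⁻¹ * bracket y ^ s) :=
        mul_le_mul_of_nonneg_left (by linarith) ha.le
      _ = _ := by field_simp

/-! ### Young's inequality -/

theorem lintegral_mul_sq_le {α : Type*} [MeasurableSpace α] {μ : Measure α} {a m : α → ℝ≥0∞}
    (ha : AEMeasurable a μ) (hm : AEMeasurable m μ) :
    (∫⁻ x, a x * m x ∂μ) ^ 2 ≤ (∫⁻ x, a x ∂μ) * ∫⁻ x, a x * m x ^ 2 ∂μ := by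
  have half : (0 : ℝ) ≤ 1 / 2 := by norm_num
  have hsq : ∀ z : ℝ≥0∞, (z ^ (1 / 2 : ℝ)) ^ (2 : ℝ) = z := fun z => by
    rw [← ENNReal.rpow_mul]; norm_num
  have hsq' : ∀ z : ℝ≥0∞, z ^ (1 / 2 : ℝ) * z ^ (1 / 2 : ℝ) = z := fun z => by
    rw [← ENNReal.rpow_add_of_nonneg _ _ half half]; norm_num
  have key := ENNReal.lintegral_mul_le_Lp_mul_Lq μ Real.HolderConjugate.two_two
    (ha.pow_const (1 / 2 : ℝ)) ((ha.pow_const (1 / 2 : ℝ)).mul hm)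
  have e1 : ∀ x, ((fun x => a x ^ (1 / 2 : ℝ)) * ((fun x => a x ^ (1 / 2 : ℝ)) * m)) x
      = a x * m x := fun x => by
    simp only [Pi.mul_apply]; rw [← mul_assoc, hsq']
  have e2 : ∀ x, ((fun x => a x ^ (1 / 2 : ℝ)) * m) x ^ (2 : ℝ) = a x * m x ^ 2 := fun x => by
    simp only [Pi.mul_apply]
    rw [ENNReal.mul_rpow_of_nonneg _ _ (by norm_num), hsq, ENNReal.rpow_two]
  simp only [e1, e2, hsq] at key
  calc (∫⁻ x, a x * m x ∂μ) ^ 2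
      ≤ ((∫⁻ x, a x ∂μ) ^ (1 / 2 : ℝ) * (∫⁻ x, a x * m x ^ 2 ∂μ) ^ (1 / 2 : ℝ)) ^ 2 := by
        gcongr
    _ = _ := by rw [mul_pow, ← ENNReal.rpow_two, ← ENNReal.rpow_two, hsq, hsq]

/-- Young's inequality `‖a * m‖₂ ≤ ‖a‖₁ ‖m‖₂`. It is used on `ℝ` and on `ℤ`. -/
theorem lintegral_conv_sq_le {α : Type*} [AddCommGroup α] [MeasurableSpace α] [MeasurableAdd₂ α]
    [MeasurableNeg α] (μ : Measure α) [SFinite μ] [μ.IsAddLeftInvariant] [μ.IsNegInvariant]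
    {a m : α → ℝ≥0∞} (ha : Measurable a) (hm : AEMeasurable m μ) :
    ∫⁻ x, (∫⁻ y, a (x - y) * m y ∂μ) ^ 2 ∂μ ≤ (∫⁻ x, a x ∂μ) ^ 2 * ∫⁻ x, m x ^ 2 ∂μ := by
  have hsub : Measurable fun p : α × α => p.1 - p.2 := by
    simp_rw [sub_eq_add_neg]; exact measurable_fst.add measurable_snd.neg
  have hmeas : AEMeasurable (Function.uncurry fun x y => a (x - y) * m y ^ 2) (μ.prod μ) :=
    (ha.comp hsub).aemeasurable.mul ((hm.comp_snd).pow_const 2)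
  have hm1 : ∀ x, Measurable fun y => a (x - y) := fun x => by
    exact ha.comp (hsub.comp (measurable_const.prodMk measurable_id))
  have e1 : ∀ x, ∫⁻ y, a (x - y) ∂μ = ∫⁻ y, a y ∂μ := fun x =>
    lintegral_sub_left_eq_self a x
  have e2 : ∀ y, ∫⁻ x, a (x - y) ∂μ = ∫⁻ x, a x ∂μ := fun y =>
    lintegral_sub_right_eq_self a y
  calc ∫⁻ x, (∫⁻ y, a (x - y) * m y ∂μ) ^ 2 ∂μ
      ≤ ∫⁻ x, (∫⁻ y, a y ∂μ) * ∫⁻ y, a (x - y) * m y ^ 2 ∂μ ∂μ := by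
        refine lintegral_mono fun x => ?_
        rw [← e1 x]
        exact lintegral_mul_sq_le (hm1 x).aemeasurable hm
    _ = (∫⁻ y, a y ∂μ) * ∫⁻ x, ∫⁻ y, a (x - y) * m y ^ 2 ∂μ ∂μ :=
        lintegral_const_mul'' _ hmeas.lintegral_prod_right'
    _ = (∫⁻ y, a y ∂μ) * ∫⁻ y, ∫⁻ x, a (x - y) * m y ^ 2 ∂μ ∂μ := by
        rw [lintegral_lintegral_swap hmeas]
    _ = (∫⁻ y, a y ∂μ) * ∫⁻ y, (∫⁻ x, a x ∂μ) * m y ^ 2 ∂μ := by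
        congr 1
        refine lintegral_congr fun y => ?_
        rw [lintegral_mul_const, e2]
        exact ha.comp (hsub.comp (measurable_id.prodMk measurable_const))
    _ = _ := by
        rw [lintegral_const_mul'' _ (hm.pow_const 2), sq, mul_assoc]

theorem tsum_conv_sq_le (a m : ℤ → ℝ≥0∞) :
    ∑' n, (∑' k, a (n - k) * m k) ^ 2 ≤ (∑' n, a n) ^ 2 * ∑' n, m n ^ 2 := by
  have hbij : ∀ f : ℤ → ℤ, Function.Bijective f →
      Measure.map f (Measure.count : Measure ℤ) = Measure.count := fun f hf => by
    ext s hs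
    rw [Measure.map_apply (measurable_of_countable f) hs, Measure.count_apply (.of_discrete),
      Measure.count_apply hs, encard_preimage_of_bijective hf]
  have : (Measure.count : Measure ℤ).IsAddLeftInvariant :=
    ⟨fun g => hbij _ (AddGroup.addLeft_bijective g)⟩
  have : (Measure.count : Measure ℤ).IsNegInvariant := ⟨hbij _ neg_involutive.bijective⟩
  have h := lintegral_conv_sq_le (Measure.count : Measure ℤ) (measurable_of_countable a)
    (measurable_of_countable m).aemeasurable
  simpa only [lintegral_count] using h

/-! ### Resonant frequencies -/

theorem pow_succ_le_pow_sub_pow (j : ℕ) {x y : ℝ} (hx : 1 ≤ x) (hyx : y ≤ x - 1) :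
    x ^ (2 * j) ≤ x ^ (2 * j + 1) - y ^ (2 * j + 1) := by
  have h1 : y ^ (2 * j + 1) ≤ (x - 1) ^ (2 * j + 1) := by
    exact (Odd.strictMono_pow (n := 2 * j + 1) ⟨j, rfl⟩).monotone hyx
  have h2 : (x - 1) ^ (2 * j) ≤ x ^ (2 * j) :=
    pow_le_pow_left₀ (by linarith) (by linarith) _
  have h3 : (x - 1) * (x - 1) ^ (2 * j) ≤ (x - 1) * x ^ (2 * j) :=
    mul_le_mul_of_nonneg_left h2 (by linarith)
  rw [pow_succ (x - 1)] at h1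
  rw [pow_succ x]
  linarith

theorem abs_pow_le_abs_pow_sub_pow (j : ℕ) {k n : ℤ} (hkn : k ≠ n) (h : |n| ≤ |k|) :
    |(k : ℝ)| ^ (2 * j) ≤ |(k : ℝ) ^ (2 * j + 1) - (n : ℝ) ^ (2 * j + 1)| := by
  have hodd : Odd (2 * j + 1) := ⟨j, rfl⟩
  rcases le_or_gt 0 k with hk | hk
  · have hnk : n ≤ k - 1 := by
      have := le_abs_self n; rw [abs_of_nonneg hk] at h; omega
    have hk1 : 1 ≤ k := by
      rw [abs_of_nonneg hk] at h; have := neg_abs_le n; omega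
    rw [abs_of_nonneg (by exact_mod_cast hk)]
    exact (pow_succ_le_pow_sub_pow j (by exact_mod_cast hk1) (by exact_mod_cast hnk)).trans
      (le_abs_self _)
  · have hnk : -n ≤ -k - 1 := by
      have := neg_abs_le n; rw [abs_of_neg hk] at h; omega
    rw [abs_of_neg (by exact_mod_cast hk)]
    have := pow_succ_le_pow_sub_pow j (x := -(k : ℝ)) (y := -(n : ℝ))
      (by exact_mod_cast (by omega : 1 ≤ -k)) (by exact_mod_cast hnk)
    rw [hodd.neg_pow, hodd.neg_pow] at this
    rw [abs_sub_comm]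
    exact this.trans (by rw [neg_sub_neg]; exact le_abs_self _)

/-- The pair `(k, ξ)` is resonant when `ξ` is close to `k^(2j+1)`, on the scale of the spacing
`|k|^(2j)` of these powers. -/
def Resonant (j : ℕ) (k : ℤ) (ξ : ℝ) : Prop :=
  |ξ - (k : ℝ) ^ (2 * j + 1)| < |(k : ℝ)| ^ (2 * j) / 2

/-- At most one frequency is resonant with a given `ξ`. -/
theorem Resonant.unique {j : ℕ} {k n : ℤ} {ξ : ℝ} (hk : Resonant j k ξ) (hn : Resonant j n ξ) :
    k = n := by
  by_contra hne
  wlog h : |n| ≤ |k| generalizing k n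
  · exact this hn hk (Ne.symm hne) (le_of_not_ge h)
  have h1 := abs_pow_le_abs_pow_sub_pow j hne h
  have h2 : |(n : ℝ)| ^ (2 * j) ≤ |(k : ℝ)| ^ (2 * j) :=
    pow_le_pow_left₀ (abs_nonneg _) (by exact_mod_cast h) _
  have h3 := abs_sub_le ((k : ℝ) ^ (2 * j + 1)) ξ ((n : ℝ) ^ (2 * j + 1))
  rw [abs_sub_comm ((k : ℝ) ^ (2 * j + 1)) ξ] at h3
  unfold Resonant at hk hn
  linarith

theorem measurableSet_resonant (j : ℕ) (k : ℤ) : MeasurableSet {ξ | Resonant j k ξ} :=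
  (isOpen_lt (by fun_prop) continuous_const).measurableSet

theorem bracket_pow_le_of_not_resonant {j : ℕ} {k : ℤ} {ξ : ℝ} (h : ¬ Resonant j k ξ) :
    bracket k ^ (2 * j) ≤ 2 ^ (j + 1) * bracket (ξ - (k : ℝ) ^ (2 * j + 1)) := by
  set σ := ξ - (k : ℝ) ^ (2 * j + 1)
  have h' : |(k : ℝ)| ^ (2 * j) / 2 ≤ |σ| := not_lt.1 h
  have hσ : |σ| ≤ bracket σ := by
    rw [bracket, ← Real.sqrt_sq_eq_abs]; exact Real.sqrt_le_sqrt (by linarith)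
  have h1 := one_le_bracket σ
  rw [pow_mul, bracket_sq]
  rcases eq_or_ne k 0 with rfl | hk
  · have : (1 : ℝ) ≤ 2 ^ (j + 1) := one_le_pow₀ (by norm_num)
    simp only [Int.cast_zero]
    norm_num
    nlinarith
  · have hk1 : (1 : ℝ) ≤ (k : ℝ) ^ 2 := by
      have : 1 ≤ k ^ 2 := by have := sq_pos_of_ne_zero hk; omega
      exact_mod_cast this
    calc (1 + (k : ℝ) ^ 2) ^ j ≤ (2 * (k : ℝ) ^ 2) ^ j :=
          pow_le_pow_left₀ (by positivity) (by linarith) _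
      _ = 2 ^ j * |(k : ℝ)| ^ (2 * j) := by rw [mul_pow, pow_mul, sq_abs]
      _ ≤ 2 ^ j * (2 * bracket σ) := by gcongr; linarith
      _ = _ := by ring

/-- Away from resonance the modulation weight dominates the Sobolev weight. -/
theorem wt_le_of_not_resonant {j : ℕ} {k : ℤ} {ξ c ρ : ℝ} (hc : 0 ≤ c) (hρ : ρ ≤ 2 * j * c)
    (h : ¬ Resonant j k ξ) :
    wt ρ k ≤ ENNReal.ofReal ((2 ^ (j + 1)) ^ c) * wt c (ξ - (k : ℝ) ^ (2 * j + 1)) := by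
  have hb := bracket_pos (ξ - (k : ℝ) ^ (2 * j + 1))
  unfold wt
  rw [← ENNReal.ofReal_mul (by positivity), ← Real.mul_rpow (by positivity) hb.le]
  apply ENNReal.ofReal_le_ofReal
  calc bracket k ^ ρ ≤ bracket k ^ (2 * j * c) :=
        Real.rpow_le_rpow_of_exponent_le (one_le_bracket _) hρ
    _ = (bracket k ^ (2 * j)) ^ c := by
        rw [Real.rpow_mul (bracket_pos _).le]; congr 1; exact_mod_cast Real.rpow_natCast _ _
    _ ≤ _ := Real.rpow_le_rpow (by have := bracket_pos k; positivity)
        (bracket_pow_le_of_not_resonant h) hc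

/-! ### The Fourier transform on the line -/

/-- The Fourier transform `ξ ↦ ∫ e^{-itξ} h(t) dt`, in the normalisation of `stFourier`. -/
def fourierInt (h : ℝ → ℂ) (ξ : ℝ) : ℂ :=
  ∫ t : ℝ, Complex.exp (-(Complex.I * (t * ξ : ℝ))) * h t

theorem fourierInt_eq (h : ℝ → ℂ) (ξ : ℝ) : fourierInt h ξ = 𝓕 h (ξ / (2 * Real.pi)) := by
  rw [Real.fourier_real_eq_integral_exp_smul]
  refine integral_congr_ae (Filter.Eventually.of_forall fun t => ?_)
  have hpi : (Real.pi : ℂ) ≠ 0 := by exact_mod_cast Real.pi_ne_zero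
  simp only [smul_eq_mul]
  congr 2
  push_cast
  field_simp

theorem continuous_fourier_of_integrable {h : ℝ → ℂ} (hh : Integrable h) : Continuous (𝓕 h) :=
  VectorFourier.fourierIntegral_continuous Real.continuous_fourierChar
    (by exact continuous_inner) hh

theorem continuous_fourierInt {h : ℝ → ℂ} (hh : Integrable h) : Continuous (fourierInt h) := by
  have e : fourierInt h = fun ξ => 𝓕 h (ξ / (2 * Real.pi)) := funext (fourierInt_eq h)
  rw [e]
  exact (continuous_fourier_of_integrable hh).comp (by fun_prop)

theorem integral_fourier_mul_eq {h θ : ℝ → ℂ} (hh : Integrable h) (hθ : Integrable θ) :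
    ∫ x, θ x * 𝓕 h x = ∫ x, 𝓕 θ x * h x := by
  symm
  simpa using! VectorFourier.integral_bilin_fourierIntegral_eq_flip (.mul ℂ ℂ) (L := innerₗ ℝ)
    Real.continuous_fourierChar continuous_inner hθ hh

/-- For an integrable `h ∈ L²` the integral defines the `L²` Fourier transform. -/
theorem fourier_ae_eq_fourier_toLp {h : ℝ → ℂ} (hh : Integrable h) (h2 : MemLp h 2) :
    𝓕 h =ᵐ[volume] (𝓕 (h2.toLp h) : Lp ℂ 2 (volume : Measure ℝ)) := by
  refine ae_eq_of_integral_contDiff_smul_eq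
    (continuous_fourier_of_integrable hh).locallyIntegrable
    ((Lp.memLp _).locallyIntegrable (by norm_num)) fun g hg hgc => ?_
  have hG : ContDiff ℝ (⊤ : ℕ∞) fun x => (g x : ℂ) := Complex.ofRealCLM.contDiff.comp hg
  have hGc : HasCompactSupport fun x => (g x : ℂ) := hgc.comp_left Complex.ofReal_zero
  set S : SchwartzMap ℝ ℂ := hGc.toSchwartzMap hG
  have e1 : ∫ x, g x • 𝓕 h x = ∫ x, (S x) * 𝓕 h x :=
    integral_congr_ae (Filter.Eventually.of_forall fun x => Complex.real_smul)
  have e2 : ∀ w : ℝ → ℂ, ∫ x, g x • w x = ∫ x, S x • w x := fun w =>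
    integral_congr_ae (Filter.Eventually.of_forall fun x => Complex.real_smul)
  rw [e1, e2, ← Lp.toTemperedDistribution_apply, ← Lp.fourier_toTemperedDistribution_eq,
    TemperedDistribution.fourier_apply, Lp.toTemperedDistribution_apply,
    integral_fourier_mul_eq hh S.integrable]
  refine integral_congr_ae ?_
  filter_upwards [h2.coeFn_toLp] with x hx
  rw [hx, SchwartzMap.fourier_coe, smul_eq_mul]

theorem eLpNorm_two_sq {α : Type*} [MeasurableSpace α] (μ : Measure α) (h : α → ℂ) :
    eLpNorm h 2 μ ^ 2 = ∫⁻ x, ‖h x‖ₑ ^ 2 ∂μ := by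
  rw [eLpNorm_eq_lintegral_rpow_enorm_toReal (by norm_num) (by norm_num), ← ENNReal.rpow_two,
    ← ENNReal.rpow_mul]
  simp

theorem lintegral_comp_div {w : ℝ → ℝ≥0∞} (hw : Measurable w) {a : ℝ} (ha : 0 < a) :
    ∫⁻ ξ, w (ξ / a) = ENNReal.ofReal a * ∫⁻ ξ, w ξ := by
  have h := Real.map_volume_mul_left (a := a⁻¹) (inv_ne_zero ha.ne')
  rw [inv_inv, abs_of_pos ha] at h
  rw [← smul_eq_mul, ← lintegral_smul_measure, ← h, lintegral_map hw (by fun_prop)]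
  refine lintegral_congr fun ξ => by rw [div_eq_inv_mul]

/-- Plancherel's theorem. -/
theorem lintegral_fourierInt_sq {h : ℝ → ℂ} (hh : Integrable h) (h2 : MemLp h 2) :
    ∫⁻ ξ, ‖fourierInt h ξ‖ₑ ^ 2 = ENNReal.ofReal (2 * Real.pi) * ∫⁻ t, ‖h t‖ₑ ^ 2 := by
  simp only [fourierInt_eq]
  have hc := continuous_fourier_of_integrable hh
  rw [lintegral_comp_div (w := fun x => ‖𝓕 h x‖ₑ ^ 2) (by fun_prop) Real.two_pi_pos]
  congr 1
  rw [← eLpNorm_two_sq, ← eLpNorm_two_sq, eLpNorm_congr_ae (fourier_ae_eq_fourier_toLp hh h2)]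
  congr 1
  have := Lp.norm_fourier_eq (h2.toLp h)
  rw [Lp.norm_toLp, Lp.norm_def,
    ENNReal.toReal_eq_toReal_iff' (Lp.eLpNorm_ne_top _) h2.2.ne] at this
  exact this

/-- The inverse Fourier transform of an `L²` function, characterised by duality with `L¹ ∩ L²`. -/
theorem exists_dual_fourierInt {G : ℝ → ℂ} (hG : MemLp G 2) :
    ∃ γ : ℝ → ℂ, MemLp γ 2 ∧ ∀ θ : ℝ → ℂ, Integrable θ → MemLp θ 2 →
      ∫ t, γ t * θ t = ∫ τ, G τ * fourierInt θ (-τ) := by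
  have hpi := Real.two_pi_pos
  have hG' : MemLp (fun η => G (2 * Real.pi * η)) 2 := by
    have h := Real.map_volume_mul_left hpi.ne'
    have h1 : MemLp G 2 (Measure.map (fun x => 2 * Real.pi * x) volume) := by
      rw [h]; exact hG.smul_measure ENNReal.ofReal_ne_top
    exact (memLp_map_measure_iff h1.1 (by fun_prop)).1 h1
  set g : Lp ℂ 2 (volume : Measure ℝ) := hG'.toLp _
  refine ⟨fun t => 2 * Real.pi * (𝓕⁻ g : Lp ℂ 2 (volume : Measure ℝ)) t,
    (Lp.memLp (𝓕⁻ g : Lp ℂ 2 (volume : Measure ℝ))).const_mul _, fun θ hθ hθ2 => ?_⟩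
  -- Plancherel's theorem for the inner product of `𝓕⁻ g` with the complex conjugate of `θ`.
  have hκ : Integrable fun t => starRingEnd ℂ (θ t) :=
    (Complex.conjCLE.toContinuousLinearMap).integrable_comp hθ
  have hκ2 : MemLp (fun t => starRingEnd ℂ (θ t)) 2 := hθ2.star
  have hconj : ∀ η, starRingEnd ℂ (𝓕 (fun t => starRingEnd ℂ (θ t)) η)
      = fourierInt θ (-(2 * Real.pi * η)) := fun η => by
    rw [Real.fourier_real_eq_integral_exp_smul, ← integral_conj, fourierInt]
    refine integral_congr_ae (Filter.Eventually.of_forall fun t => ?_)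
    simp only [smul_eq_mul, map_mul, ← Complex.exp_conj, Complex.conj_conj, Complex.conj_ofReal,
      Complex.conj_I]
    congr 2
    push_cast
    ring
  have e : ∫ t, (𝓕⁻ g : Lp ℂ 2 (volume : Measure ℝ)) t * θ t
      = ∫ η, G (2 * Real.pi * η) * fourierInt θ (-(2 * Real.pi * η)) := by
    calc ∫ t, (𝓕⁻ g : Lp ℂ 2 (volume : Measure ℝ)) t * θ t
        = inner ℂ (hκ2.toLp _) (𝓕⁻ g) := by
          rw [L2.inner_def]
          refine integral_congr_ae ?_
          filter_upwards [hκ2.coeFn_toLp] with t ht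
          simp [ht]
      _ = inner ℂ (𝓕 (hκ2.toLp _)) g := by
          rw [← Lp.inner_fourier_eq, FourierTransform.fourier_fourierInv_eq]
      _ = _ := by
          rw [L2.inner_def]
          refine integral_congr_ae ?_
          filter_upwards [hG'.coeFn_toLp, fourier_ae_eq_fourier_toLp hκ hκ2] with η hη hκη
          rw [← hκη, hη, ← hconj]
          simp
  calc ∫ t, 2 * Real.pi * (𝓕⁻ g : Lp ℂ 2 (volume : Measure ℝ)) t * θ t
      = 2 * Real.pi * ∫ t, (𝓕⁻ g : Lp ℂ 2 (volume : Measure ℝ)) t * θ t := by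
        rw [← integral_const_mul]; simp only [mul_assoc]
    _ = _ := by
        rw [e, Measure.integral_comp_mul_left (fun τ => G τ * fourierInt θ (-τ)),
          abs_of_pos (inv_pos.2 hpi), Complex.real_smul, ← mul_assoc]
        have : (Real.pi : ℂ) ≠ 0 := by exact_mod_cast Real.pi_ne_zero
        push_cast
        rw [mul_inv_cancel₀ (by simp [this]), one_mul]

/-- The Fourier transform of a test function decays faster than any power. -/
theorem lintegral_wt_fourierInt_lt_top {θ : ℝ → ℂ} (hθ : ContDiff ℝ (⊤ : ℕ∞) θ)
    (hθc : HasCompactSupport θ) (s : ℝ) : ∫⁻ ξ, wt s ξ * ‖fourierInt θ ξ‖ₑ < ⊤ := by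
  set S : SchwartzMap ℝ ℂ := 𝓕 (hθc.toSchwartzMap hθ)
  obtain ⟨N, hN⟩ := exists_nat_ge s
  have hint : Integrable fun y : ℝ => 2 ^ N * (‖S y‖ + (2 * Real.pi) ^ N * (‖y‖ ^ N * ‖S y‖)) := by
    have h0 := S.integrable_pow_mul volume 0
    simp only [pow_zero, one_mul] at h0
    exact (h0.add ((S.integrable_pow_mul volume N).const_mul _)).const_mul _
  have hint' := hint.comp_div Real.two_pi_pos.ne'
  refine lt_of_le_of_lt (lintegral_mono fun ξ => ?_) hint'.lintegral_lt_top
  rw [wt, ← ofReal_norm, ← ENNReal.ofReal_mul (Real.rpow_nonneg (bracket_pos ξ).le s)]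
  apply ENNReal.ofReal_le_ofReal
  have hS : ‖fourierInt θ ξ‖ = ‖S (ξ / (2 * Real.pi))‖ := by
    rw [fourierInt_eq, SchwartzMap.fourier_coe]; rfl
  have hb : bracket ξ ^ s ≤ 2 ^ N * (1 + |ξ| ^ N) := by
    calc bracket ξ ^ s ≤ bracket ξ ^ (N : ℝ) :=
          Real.rpow_le_rpow_of_exponent_le (one_le_bracket ξ) hN
      _ = bracket ξ ^ N := Real.rpow_natCast _ _
      _ ≤ (1 + |ξ|) ^ N := pow_le_pow_left₀ (bracket_pos ξ).le (bracket_le_one_add_abs ξ) N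
      _ ≤ (2 * max 1 |ξ|) ^ N := by
          refine pow_le_pow_left₀ (by positivity) ?_ N
          have := le_max_left 1 |ξ|; have := le_max_right 1 |ξ|; linarith
      _ = 2 ^ N * (max 1 |ξ|) ^ N := mul_pow _ _ _
      _ ≤ _ := by
          gcongr
          rcases max_cases 1 |ξ| with ⟨h, _⟩ | ⟨h, _⟩ <;> rw [h]
          · rw [one_pow]; have : 0 ≤ |ξ| ^ N := by positivity
            linarith
          · linarith
  rw [hS]
  have hy : ‖ξ / (2 * Real.pi)‖ ^ N = |ξ| ^ N / (2 * Real.pi) ^ N := by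
    rw [Real.norm_eq_abs, abs_div, abs_of_pos Real.two_pi_pos, div_pow]
  rw [hy]
  calc bracket ξ ^ s * ‖S (ξ / (2 * Real.pi))‖
      ≤ 2 ^ N * (1 + |ξ| ^ N) * ‖S (ξ / (2 * Real.pi))‖ := by gcongr
    _ = _ := by field_simp

/-! ### Fourier coefficients on the circle -/

/-- The Fourier coefficient `(2π)⁻¹ ∫_𝕋 e^{-imx} χ(x) dx`. -/
def torusCoeff (χ : Torus → ℂ) (m : ℤ) : ℂ :=
  ((2 * Real.pi : ℝ) : ℂ)⁻¹ * ∫ x : Torus, fourier (-m) x * χ x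

theorem fourier_coe_real (n : ℤ) (x : ℝ) :
    fourier n (x : Torus) = Complex.exp (Complex.I * n * x) := by
  rw [fourier_coe_apply]
  congr 1
  have : (Real.pi : ℂ) ≠ 0 := by exact_mod_cast Real.pi_ne_zero
  push_cast
  field_simp

theorem torusCoeff_eq_intervalIntegral (χ : Torus → ℂ) (m : ℤ) :
    torusCoeff χ m = ((2 * Real.pi : ℝ) : ℂ)⁻¹ *
      ∫ x in (0 : ℝ)..2 * Real.pi, Complex.exp (-(Complex.I * m * x)) * χ (x : Torus) := by
  rw [torusCoeff, ← AddCircle.intervalIntegral_preimage (2 * Real.pi) 0, zero_add]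
  simp only [fourier_coe_real]
  congr 2
  funext x
  push_cast
  ring_nf

theorem torusCoeff_one (m : ℤ) : torusCoeff (fun _ => 1) m = if m = 0 then 1 else 0 := by
  have hpi : (Real.pi : ℂ) ≠ 0 := by exact_mod_cast Real.pi_ne_zero
  rw [torusCoeff_eq_intervalIntegral]
  split_ifs with h
  · subst h
    simp only [Int.cast_zero, mul_zero, zero_mul, neg_zero, Complex.exp_zero, mul_one,
      intervalIntegral.integral_const, sub_zero, Complex.real_smul]
    push_cast
    exact inv_mul_cancel₀ (by simp [hpi])
  · have hc : -(Complex.I * m) ≠ 0 := by simp [h]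
    have e : ∀ x : ℝ, Complex.exp (-(Complex.I * m * x)) * 1
        = Complex.exp (-(Complex.I * m) * x) := fun x => by rw [mul_one, neg_mul]
    have e1 : Complex.exp (-(Complex.I * m) * (2 * Real.pi : ℝ)) = 1 := by
      rw [← Complex.exp_int_mul_two_pi_mul_I (-m)]
      congr 1
      push_cast
      ring
    simp only [e]
    rw [integral_exp_mul_complex hc, e1]
    simp

/-- Integration by parts against `e^{-imx}` for a periodic function. -/
theorem integral_exp_mul_deriv {f : ℝ → ℂ} (hf : ContDiff ℝ (⊤ : ℕ∞) f)
    (hper : Function.Periodic f (2 * Real.pi)) (m : ℤ) :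
    ∫ x in (0 : ℝ)..2 * Real.pi, Complex.exp (-(Complex.I * m * x)) * deriv f x
      = Complex.I * m * ∫ x in (0 : ℝ)..2 * Real.pi, Complex.exp (-(Complex.I * m * x)) * f x := by
  have hE : ∀ x : ℝ, HasDerivAt (fun x : ℝ => Complex.exp (-(Complex.I * m * x)))
      (-(Complex.I * m) * Complex.exp (-(Complex.I * m * x))) x := fun x => by
    have h1 : HasDerivAt (fun x : ℝ => -(Complex.I * m * (x : ℂ))) (-(Complex.I * m)) x := by
      simpa using ((hasDerivAt_id (x : ℂ)).comp_ofReal.const_mul (Complex.I * m)).fun_neg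
    simpa [mul_comm] using h1.cexp
  have hd : Continuous (deriv f) := hf.continuous_deriv (by simp)
  rw [intervalIntegral.integral_mul_deriv_eq_deriv_mul (fun x _ => hE x)
    (fun x _ => ((hf.differentiable (by simp)) x).hasDerivAt)
    (Continuous.intervalIntegrable (by fun_prop) _ _) (hd.intervalIntegrable _ _)]
  have e1 : Complex.exp (-(Complex.I * m * (2 * Real.pi : ℝ))) = 1 := by
    rw [← Complex.exp_int_mul_two_pi_mul_I (-m)]
    congr 1
    push_cast
    ring
  have e2 : f (2 * Real.pi) = f 0 := by simpa using hper 0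
  rw [e1, e2, ← intervalIntegral.integral_const_mul]
  simp only [Complex.ofReal_zero, mul_zero, neg_zero, Complex.exp_zero, sub_self, zero_sub]
  rw [← intervalIntegral.integral_neg]
  refine intervalIntegral.integral_congr fun x _ => ?_
  ring

/-- The operator `1 - ∂_x²` multiplies the `m`-th Fourier coefficient by `1 + m²`. -/
theorem exists_bound_integral_exp_mul (M : ℕ) {f : ℝ → ℂ} (hf : ContDiff ℝ (⊤ : ℕ∞) f)
    (hper : Function.Periodic f (2 * Real.pi)) : ∃ C : ℝ, ∀ m : ℤ, (1 + (m : ℝ) ^ 2) ^ M *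
      ‖∫ x in (0 : ℝ)..2 * Real.pi, Complex.exp (-(Complex.I * m * x)) * f x‖ ≤ C := by
  induction M generalizing f with
  | zero =>
    refine ⟨∫ x in (0 : ℝ)..2 * Real.pi, ‖f x‖, fun m => ?_⟩
    rw [pow_zero, one_mul]
    refine (intervalIntegral.norm_integral_le_integral_norm Real.two_pi_pos.le).trans_eq ?_
    refine intervalIntegral.integral_congr fun x _ => ?_
    have : -(Complex.I * m * x) = ((-(m * x) : ℝ) : ℂ) * Complex.I := by push_cast; ring
    simp only [norm_mul]
    rw [this, Complex.norm_exp_ofReal_mul_I, one_mul]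
  | succ M ih =>
    have hf1 : ContDiff ℝ (⊤ : ℕ∞) (deriv f) := (contDiff_infty_iff_deriv.1 hf).2
    have hf2 : ContDiff ℝ (⊤ : ℕ∞) (deriv (deriv f)) := (contDiff_infty_iff_deriv.1 hf1).2
    have hper' : ∀ g : ℝ → ℂ, Function.Periodic g (2 * Real.pi) →
        Function.Periodic (deriv g) (2 * Real.pi) := fun g hg x => by
      rw [← deriv_comp_add_const, hg.funext]
    obtain ⟨C, hC⟩ := ih (f := fun x => f x - deriv (deriv f) x) (hf.sub hf2)
      (hper.sub (hper' _ (hper' _ hper)))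
    refine ⟨C, fun m => ?_⟩
    have e : ∫ x in (0 : ℝ)..2 * Real.pi, Complex.exp (-(Complex.I * m * x)) *
        (f x - deriv (deriv f) x) = ((1 + (m : ℝ) ^ 2 : ℝ) : ℂ) *
        ∫ x in (0 : ℝ)..2 * Real.pi, Complex.exp (-(Complex.I * m * x)) * f x := by
      have hcf := hf.continuous
      have hcf2 := hf2.continuous
      simp only [mul_sub]
      rw [intervalIntegral.integral_sub (Continuous.intervalIntegrable (by fun_prop) _ _)
        (Continuous.intervalIntegrable (by fun_prop) _ _),
        integral_exp_mul_deriv hf1 (hper' _ hper), integral_exp_mul_deriv hf hper]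
      push_cast
      linear_combination (-(m : ℂ) ^ 2 * ∫ x in (0 : ℝ)..2 * Real.pi,
        Complex.exp (-(Complex.I * m * x)) * f x) * Complex.I_sq
    have h := hC m
    rw [e, norm_mul, Complex.norm_real, Real.norm_of_nonneg (by positivity)] at h
    rw [pow_succ, mul_assoc]
    exact h

theorem summable_one_div_one_add_int_sq : Summable fun m : ℤ => 1 / (1 + (m : ℝ) ^ 2) := by
  have h1 : Summable fun m : ℤ => 1 / (m : ℝ) ^ 2 := Real.summable_one_div_int_pow.2 one_lt_two
  have h2 : Summable fun m : ℤ => if m = 0 then (1 : ℝ) else 0 := (hasSum_ite_eq 0 1).summable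
  refine Summable.of_nonneg_of_le (fun m => by positivity) (fun m => ?_) (h1.add h2)
  split_ifs with h
  · subst h; simp
  · rw [add_zero]
    have : (m : ℝ) ≠ 0 := by exact_mod_cast h
    exact one_div_le_one_div_of_le (by positivity) (by linarith)

theorem tsum_wt_torusCoeff_lt_top {χ : Torus → ℂ}
    (hχ : ContDiff ℝ (⊤ : ℕ∞) fun x : ℝ => χ (x : Torus))
    (s : ℝ) : ∑' m : ℤ, wt s m * ‖torusCoeff χ m‖ₑ < ⊤ := by
  obtain ⟨M, hM⟩ := exists_nat_ge ((s + 2) / 2)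
  obtain ⟨C, hC⟩ := exists_bound_integral_exp_mul M hχ fun x => by
    simp only [AddCircle.coe_add_period]
  have hs : Summable fun m : ℤ => (2 * Real.pi)⁻¹ * (C * (1 / (1 + (m : ℝ) ^ 2))) :=
    (summable_one_div_one_add_int_sq.mul_left C).mul_left _
  refine lt_of_le_of_lt (ENNReal.tsum_le_tsum fun m => ?_) hs.tsum_ofReal_lt_top
  have hb := bracket_pos m
  rw [wt, ← ofReal_norm, ← ENNReal.ofReal_mul (Real.rpow_nonneg hb.le s)]
  apply ENNReal.ofReal_le_ofReal
  rw [torusCoeff_eq_intervalIntegral, norm_mul, norm_inv, Complex.norm_real,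
    Real.norm_of_nonneg Real.two_pi_pos.le]
  set J := ‖∫ x in (0 : ℝ)..2 * Real.pi, Complex.exp (-(Complex.I * m * x)) * χ (x : Torus)‖
  have h1 : bracket m ^ s * (1 + (m : ℝ) ^ 2) ≤ (1 + (m : ℝ) ^ 2) ^ M := by
    rw [← bracket_sq, ← pow_mul, ← Real.rpow_natCast (bracket m) (2 * M),
      ← Real.rpow_two, ← Real.rpow_add hb]
    refine Real.rpow_le_rpow_of_exponent_le (one_le_bracket _) ?_
    push_cast
    linarith
  have h2 : bracket m ^ s * J ≤ C * (1 / (1 + (m : ℝ) ^ 2)) := by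
    rw [mul_one_div, le_div_iff₀ (by positivity)]
    calc bracket m ^ s * J * (1 + (m : ℝ) ^ 2) = bracket m ^ s * (1 + (m : ℝ) ^ 2) * J := by ring
      _ ≤ (1 + (m : ℝ) ^ 2) ^ M * J := by gcongr
      _ ≤ C := hC m
  calc bracket m ^ s * ((2 * Real.pi)⁻¹ * J) = (2 * Real.pi)⁻¹ * (bracket m ^ s * J) := by ring
    _ ≤ _ := mul_le_mul_of_nonneg_left h2 (by positivity)

/-- Every nonempty open subset of the circle carries a smooth cutoff with nonzero mean. -/
theorem exists_cutoff {U : Set Torus} (hU : IsOpen U) (hne : U.Nonempty) :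
    ∃ χ : Torus → ℂ, (ContDiff ℝ (⊤ : ℕ∞) fun x : ℝ => χ (x : Torus)) ∧ tsupport χ ⊆ U ∧
      torusCoeff χ 0 ≠ 0 := by
  obtain ⟨p, hp⟩ := hne
  obtain ⟨x₀, rfl⟩ := QuotientAddGroup.mk_surjective p
  have hV : IsOpen ((fun x : ℝ => (x : Torus)) ⁻¹' U) :=
    hU.preimage (AddCircle.continuous_mk' _)
  obtain ⟨δ, hδ, hball⟩ := Metric.isOpen_iff.1 hV x₀ hp
  set η := min (δ / 2) 1
  have hη : 0 < η := by positivity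
  have hηδ : η < δ := (min_le_left _ _).trans_lt (by linarith)
  have hη1 : η ≤ 1 := min_le_right _ _
  have hπ := Real.pi_gt_three
  have hper : Function.Periodic (fun x => Real.cos (x - x₀)) (2 * Real.pi) := fun x => by
    simp only
    rw [add_sub_right_comm, Real.cos_add_two_pi]
  set c : Torus → ℝ := hper.lift
  have hcx : ∀ x : ℝ, c (x : Torus) = Real.cos (x - x₀) := fun x => hper.lift_coe x
  have hc : Continuous c := by
    exact continuous_coinduced_dom.2 (by fun_prop : Continuous fun x : ℝ => Real.cos (x - x₀))
  set χ : Torus → ℝ := fun y => Real.smoothTransition (c y - Real.cos η)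
  have hχc : Continuous χ := Real.smoothTransition.continuous.comp (by fun_prop)
  have hcos : Real.cos η < 1 := by
    rw [← Real.cos_zero]
    exact Real.cos_lt_cos_of_nonneg_of_le_pi le_rfl (by linarith) hη
  refine ⟨fun y => (χ y : ℂ), ?_, ?_, ?_⟩
  · refine Complex.ofRealCLM.contDiff.comp (Real.smoothTransition.contDiff.comp ?_)
    simp only [hcx]
    exact (Real.contDiff_cos.comp (contDiff_id.sub contDiff_const)).sub contDiff_const
  · have hsub : tsupport (fun y => (χ y : ℂ)) ⊆ {y | Real.cos η ≤ c y} := by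
      refine closure_minimal (fun y hy => ?_) (isClosed_le continuous_const hc)
      by_contra hn
      rw [mem_ofPred_eq, not_le] at hn
      refine hy ?_
      simp only [χ]
      rw [Real.smoothTransition.zero_of_nonpos (sub_nonpos.2 hn.le),
        Complex.ofReal_zero]
    refine hsub.trans fun y hy => ?_
    obtain ⟨x, hx, rfl⟩ : y ∈ ((↑) : ℝ → Torus) ''
        Icc (x₀ - Real.pi) (x₀ - Real.pi + 2 * Real.pi) := by
      rw [AddCircle.coe_image_Icc_eq]; trivial
    have hx' : |x - x₀| ≤ Real.pi := abs_le.2 ⟨by linarith [hx.1], by linarith [hx.2]⟩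
    refine hball ?_
    rw [Metric.mem_ball, Real.dist_eq]
    by_contra hn
    have h1 : Real.cos |x - x₀| < Real.cos η :=
      Real.cos_lt_cos_of_nonneg_of_le_pi hη.le hx' (by linarith)
    rw [Real.cos_abs, ← hcx] at h1
    exact absurd hy (not_le.2 h1)
  · have hpos : 0 < ∫ y : Torus, χ y := by
      refine hχc.integral_pos_of_hasCompactSupport_nonneg_nonzero
        (HasCompactSupport.of_compactSpace _) (fun y => Real.smoothTransition.nonneg _)
        (x := (x₀ : Torus)) ?_
      refine (Real.smoothTransition.pos_of_pos ?_).ne'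
      rw [hcx, sub_self, Real.cos_zero]
      linarith
    rw [torusCoeff]
    simp only [neg_zero, fourier_zero, one_mul, integral_complex_ofReal]
    have := Real.pi_pos.ne'
    simp [hpos.ne', this]

/-! ### Product test functions -/

/-- The product `θ(t) χ(x)`. -/
def tens (θ : ℝ → ℂ) (χ : Torus → ℂ) : ℝ × Torus → ℂ := fun p => θ p.1 * χ p.2

/-- The modulation `e^{-itξ} ψ(t)`. -/
def modulate (ψ : ℝ → ℂ) (ξ t : ℝ) : ℂ := Complex.exp (-(Complex.I * (t * ξ : ℝ))) * ψ t

theorem tens_mem {θ : ℝ → ℂ} {χ : Torus → ℂ} {I : Set ℝ} {U : Set Torus}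
    (hθ : ContDiff ℝ (⊤ : ℕ∞) θ) (hθc : HasCompactSupport θ) (hθI : tsupport θ ⊆ I)
    (hχ : ContDiff ℝ (⊤ : ℕ∞) fun x : ℝ => χ (x : Torus)) (hχU : tsupport χ ⊆ U) :
    tens θ χ ∈ testFn (I ×ˢ U) := by
  have hsub : tsupport (tens θ χ) ⊆ tsupport θ ×ˢ tsupport χ := by
    refine closure_minimal (fun p hp => ?_) ((isClosed_tsupport θ).prod (isClosed_tsupport χ))
    exact ⟨subset_tsupport θ (left_ne_zero_of_mul hp), subset_tsupport χ (right_ne_zero_of_mul hp)⟩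
  refine ⟨?_, ?_, hsub.trans (prod_mono hθI hχU)⟩
  · exact (hθ.comp contDiff_fst).mul (hχ.comp contDiff_snd)
  · exact (IsCompact.prod hθc (isClosed_tsupport χ).isCompact).of_isClosed_subset
      (isClosed_tsupport _) hsub

theorem contDiff_modulate {ψ : ℝ → ℂ} (hψ : ContDiff ℝ (⊤ : ℕ∞) ψ) (ξ : ℝ) :
    ContDiff ℝ (⊤ : ℕ∞) (modulate ψ ξ) := by
  unfold modulate
  refine ContDiff.mul (ContDiff.cexp (ContDiff.neg (contDiff_const.mul ?_))) hψ
  exact Complex.ofRealCLM.contDiff.comp (contDiff_id.mul contDiff_const)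

theorem support_modulate (ψ : ℝ → ℂ) (ξ : ℝ) :
    Function.support (modulate ψ ξ) = Function.support ψ := by
  ext t
  simp [modulate, Complex.exp_ne_zero]

theorem tsupport_modulate (ψ : ℝ → ℂ) (ξ : ℝ) : tsupport (modulate ψ ξ) = tsupport ψ := by
  rw [tsupport, support_modulate, ← tsupport]

theorem hasCompactSupport_modulate {ψ : ℝ → ℂ} (h : HasCompactSupport ψ) (ξ : ℝ) :
    HasCompactSupport (modulate ψ ξ) := by
  rwa [HasCompactSupport, tsupport_modulate]

theorem deriv_modulate {ψ : ℝ → ℂ} (hψ : ContDiff ℝ (⊤ : ℕ∞) ψ) (ξ : ℝ) :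
    deriv (modulate ψ ξ) = fun t =>
      modulate (deriv ψ) ξ t - Complex.I * ξ * modulate ψ ξ t := by
  funext t
  have h1 : HasDerivAt (fun t : ℝ => -(Complex.I * ((t * ξ : ℝ) : ℂ))) (-(Complex.I * ξ)) t := by
    have h0 : HasDerivAt (fun t : ℝ => ((t * ξ : ℝ) : ℂ)) ξ t := by
      simpa using ((hasDerivAt_id t).mul_const ξ).ofReal_comp
    exact (h0.const_mul Complex.I).fun_neg
  have h2 := h1.cexp.fun_mul ((hψ.differentiable (by simp)) t).hasDerivAt
  have h3 := h2.deriv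
  simp only [modulate] at h3 ⊢
  rw [show (modulate ψ ξ) = fun t => Complex.exp (-(Complex.I * ((t * ξ : ℝ) : ℂ))) * ψ t from rfl,
    h3]
  ring

theorem contDiff_fourier (n : ℤ) : ContDiff ℝ (⊤ : ℕ∞) fun x : ℝ => fourier n (x : Torus) := by
  simp only [fourier_coe_real]
  exact ContDiff.cexp (contDiff_const.mul Complex.ofRealCLM.contDiff)

theorem dirDeriv_time_tens (θ : ℝ → ℂ) (χ : Torus → ℂ) :
    dirDeriv (1, 0) (tens θ χ) = tens (deriv θ) χ := by
  funext ⟨t, x⟩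
  simp only [dirDeriv, tens, mul_one, mul_zero, QuotientAddGroup.mk_zero, add_zero]
  rw [deriv_mul_const_field, deriv_comp_const_add (f := θ), add_zero]

theorem dirDeriv_space_tens (θ : ℝ → ℂ) (n : ℤ) :
    dirDeriv (0, 1) (tens θ (fourier n)) = (Complex.I * n) • tens θ (fourier n) := by
  funext ⟨t, x⟩
  obtain ⟨y, rfl⟩ := QuotientAddGroup.mk_surjective x
  have h1 : HasDerivAt (fun h : ℝ => Complex.I * n * ((y + h : ℝ) : ℂ)) (Complex.I * n) 0 := by
    simpa using (((hasDerivAt_id (0 : ℝ)).const_add y).ofReal_comp).const_mul (Complex.I * n)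
  have h2 := (h1.cexp.const_mul (θ t)).deriv
  have e : (fun h : ℝ => tens θ (fourier n) (t + h * 0, (y : Torus) + ((h * 1 : ℝ) : Torus)))
      = fun h : ℝ => θ t * Complex.exp (Complex.I * n * ((y + h : ℝ) : ℂ)) := by
    funext h
    simp only [tens, mul_zero, add_zero, mul_one]
    rw [← AddCircle.coe_add, fourier_coe_real]
  simp only [dirDeriv]
  refine (congrArg (fun F => deriv F 0) e).trans (h2.trans ?_)
  change _ = Complex.I * n * (θ t * fourier n (y : Torus))
  rw [fourier_coe_real, add_zero]
  ring

theorem distrDeriv_apply (v : ℝ × ℝ) {Ω : Set (ℝ × Torus)} (w : distr Ω) {φ : ℝ × Torus → ℂ}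
    (hφ : φ ∈ testFn Ω) :
    (distrDeriv v Ω w).1 ⟨φ, hφ⟩ = -w.1 ⟨dirDeriv v φ, dirDeriv_mem v hφ⟩ := rfl

theorem distrDeriv_pow_tens {Ω : Set (ℝ × Torus)} (m : ℕ) (w : distr Ω) {θ : ℝ → ℂ} {n : ℤ}
    (h : tens θ (fourier (-n)) ∈ testFn Ω) :
    ((distrDeriv (0, 1) Ω ^ m) w).1 ⟨_, h⟩ = (Complex.I * n) ^ m * w.1 ⟨_, h⟩ := by
  induction m generalizing w with
  | zero => simp
  | succ m ih =>
    rw [pow_succ, Module.End.mul_apply, ih, distrDeriv_apply]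
    have e : (⟨dirDeriv (0, 1) (tens θ (fourier (-n))), dirDeriv_mem _ h⟩ : testFn Ω)
        = (-(Complex.I * n)) • ⟨_, h⟩ := by
      apply Subtype.ext
      refine (dirDeriv_space_tens θ (-n)).trans ?_
      push_cast
      rw [mul_neg]
    rw [e, map_smul, smul_eq_mul]
    ring

/-- The equation on the Fourier side: the symbol of `∂_t + (-1)^(j+1) ∂_x^(2j+1)` is
`i (τ - k^(2j+1))`, and a cutoff in time contributes the term with its derivative. -/
theorem kdvOp_tens {Ω : Set (ℝ × Torus)} (j : ℕ) (w : distr Ω) {ψ : ℝ → ℂ}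
    (hψ : ContDiff ℝ (⊤ : ℕ∞) ψ) (ξ : ℝ) (n : ℤ)
    (h : tens (modulate ψ ξ) (fourier (-n)) ∈ testFn Ω)
    (h' : tens (modulate (deriv ψ) ξ) (fourier (-n)) ∈ testFn Ω) :
    (kdvOp j Ω w).1 ⟨_, h⟩ = -w.1 ⟨_, h'⟩
      + Complex.I * (ξ - (n : ℝ) ^ (2 * j + 1) : ℝ) * w.1 ⟨_, h⟩ := by
  have e1 : (kdvOp j Ω w).1 ⟨_, h⟩ = (distrDeriv (1, 0) Ω w).1 ⟨_, h⟩
      + (-1) ^ (j + 1) * ((distrDeriv (0, 1) Ω ^ (2 * j + 1)) w).1 ⟨_, h⟩ := rfl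
  have e2 : (⟨dirDeriv (1, 0) (tens (modulate ψ ξ) (fourier (-n))), dirDeriv_mem _ h⟩ : testFn Ω)
      = ⟨_, h'⟩ - (Complex.I * ξ) • ⟨_, h⟩ := by
    apply Subtype.ext
    refine (dirDeriv_time_tens _ _).trans ?_
    rw [deriv_modulate hψ]
    funext p
    change (_ - _) * _ = _ * _ - Complex.I * ξ * (_ * _)
    ring
  have e3 : (-1 : ℂ) ^ (j + 1) * (Complex.I * n) ^ (2 * j + 1)
      = -(Complex.I * (n : ℂ) ^ (2 * j + 1)) := by
    rw [mul_pow, pow_succ Complex.I, pow_mul, Complex.I_sq]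
    have : (-1 : ℂ) ^ j * (-1) ^ j = 1 := by rw [← mul_pow]; simp
    linear_combination (-Complex.I * (n : ℂ) ^ (2 * j + 1)) * this
  rw [e1, distrDeriv_apply, distrDeriv_pow_tens, e2, map_sub, map_smul, smul_eq_mul, ← mul_assoc,
    e3]
  push_cast
  ring

theorem stFourier_tens (θ : ℝ → ℂ) (χ : Torus → ℂ) (τ : ℝ) (n : ℤ) :
    stFourier (tens θ χ) τ n = fourierInt θ τ * torusCoeff χ n := by
  have e : ∀ t : ℝ, ∫ x : Torus, fourier (-n) x * Complex.exp (-(Complex.I * (t * τ : ℝ)))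
        * tens θ χ (t, x)
      = Complex.exp (-(Complex.I * (t * τ : ℝ))) * θ t * ∫ x : Torus, fourier (-n) x * χ x :=
    fun t => by
      rw [← integral_const_mul]
      refine integral_congr_ae (Filter.Eventually.of_forall fun x => ?_)
      simp only [tens]
      ring
  simp only [stFourier, e, torusCoeff, fourierInt]
  rw [integral_mul_const]
  ring

theorem fourierInt_modulate (ψ : ℝ → ℂ) (ξ τ : ℝ) :
    fourierInt (modulate ψ ξ) τ = fourierInt ψ (ξ + τ) := by
  refine integral_congr_ae (Filter.Eventually.of_forall fun t => ?_)
  simp only [modulate]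
  rw [← mul_assoc, ← Complex.exp_add]
  congr 2
  push_cast
  ring

theorem torusCoeff_mul_fourier (χ : Torus → ℂ) (n k : ℤ) :
    torusCoeff (fun x => χ x * fourier (-n) x) k = torusCoeff χ (n + k) := by
  rw [torusCoeff, torusCoeff]
  congr 2
  funext x
  rw [neg_add, fourier_add]
  ring

theorem stFourier_modulate (ψ : ℝ → ℂ) (χ : Torus → ℂ) (ξ τ : ℝ) (n k : ℤ) :
    stFourier (tens (modulate ψ ξ) fun x => χ x * fourier (-n) x) (-τ) (-k)
      = fourierInt ψ (ξ - τ) * torusCoeff χ (n - k) := by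
  rw [stFourier_tens, fourierInt_modulate, torusCoeff_mul_fourier, sub_eq_add_neg, sub_eq_add_neg]

/-! ### Square norms of families of functions -/

/-- The square `∑_k ∫ M_k(ξ)² dξ` of the norm in `ℓ²(ℤ; L²(ℝ))`. -/
def sqNorm (M : ℤ → ℝ → ℝ≥0∞) : ℝ≥0∞ := ∑' k : ℤ, ∫⁻ ξ : ℝ, M k ξ ^ 2

theorem sqNorm_mono {M N : ℤ → ℝ → ℝ≥0∞} (h : ∀ k ξ, M k ξ ≤ N k ξ) : sqNorm M ≤ sqNorm N :=
  ENNReal.tsum_le_tsum fun k => lintegral_mono fun ξ => pow_le_pow_left' (h k ξ) 2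

theorem sqNorm_const_mul (c : ℝ≥0∞) (hc : c ≠ ⊤) (M : ℤ → ℝ → ℝ≥0∞) :
    sqNorm (fun k ξ => c * M k ξ) = c ^ 2 * sqNorm M := by
  simp only [sqNorm, mul_pow]
  rw [← ENNReal.tsum_mul_left]
  exact tsum_congr fun k => lintegral_const_mul' _ _ (ENNReal.pow_ne_top hc)

theorem sqNorm_eq_lintegral_tsum {M : ℤ → ℝ → ℝ≥0∞} (hM : ∀ k, AEMeasurable (M k)) :
    sqNorm M = ∫⁻ ξ, ∑' k, M k ξ ^ 2 :=
  (lintegral_tsum fun k => (hM k).pow_const 2).symm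

theorem add_sq_le_four_mul (a b : ℝ≥0∞) : (a + b) ^ 2 ≤ 4 * (a ^ 2 + b ^ 2) := by
  wlog h : a ≤ b generalizing a b
  · rw [add_comm a, add_comm (a ^ 2)]; exact this b a (le_of_not_ge h)
  calc (a + b) ^ 2 ≤ (b + b) ^ 2 := by gcongr
    _ = 4 * b ^ 2 := by ring
    _ ≤ _ := by gcongr; exact le_add_self

theorem sqNorm_add_lt_top {M N : ℤ → ℝ → ℝ≥0∞} (hM : ∀ k, AEMeasurable (M k))
    (h1 : sqNorm M < ⊤) (h2 : sqNorm N < ⊤) : sqNorm (fun k ξ => M k ξ + N k ξ) < ⊤ := by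
  have key : sqNorm (fun k ξ => M k ξ + N k ξ) ≤ 4 * (sqNorm M + sqNorm N) := by
    rw [sqNorm, sqNorm, sqNorm, ← ENNReal.tsum_add, ← ENNReal.tsum_mul_left]
    refine ENNReal.tsum_le_tsum fun k => ?_
    rw [← lintegral_add_left' ((hM k).pow_const 2), ← lintegral_const_mul' _ _ (by norm_num)]
    exact lintegral_mono fun ξ => add_sq_le_four_mul _ _
  exact key.trans_lt (ENNReal.mul_lt_top (by norm_num) (ENNReal.add_lt_top.2 ⟨h1, h2⟩))

theorem xsbNormSq_lt_top_iff {j : ℕ} {s b : ℝ} {G : ℤ → ℝ → ℂ} :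
    xsbNormSq j s b G < ⊤ ↔ sqNorm (fun k τ =>
      wt s k * (wt b (τ - (k : ℝ) ^ (2 * j + 1)) * ‖G k τ‖ₑ)) < ⊤ := by
  have e : ∀ (k : ℤ) (τ : ℝ), ENNReal.ofReal (bracket (k : ℝ) ^ (2 * s) *
      bracket (τ - (k : ℝ) ^ (2 * j + 1)) ^ (2 * b) * ‖G k τ‖ ^ 2)
      = (wt s k * (wt b (τ - (k : ℝ) ^ (2 * j + 1)) * ‖G k τ‖ₑ)) ^ 2 := fun k τ => by
    rw [mul_pow, mul_pow, wt_sq, wt_sq, ← ofReal_norm, ← ENNReal.ofReal_pow (norm_nonneg _),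
      ← mul_assoc]
    unfold wt
    have h1 := Real.rpow_nonneg (bracket_pos (k : ℝ)).le (2 * s)
    have h2 := Real.rpow_nonneg (bracket_pos (τ - (k : ℝ) ^ (2 * j + 1))).le (2 * b)
    rw [ENNReal.ofReal_mul (mul_nonneg h1 h2), ENNReal.ofReal_mul h1]
  have hc : ENNReal.ofReal (2 * Real.pi)⁻¹ ≠ 0 := by
    simpa using Real.pi_pos
  simp only [xsbNormSq, e]
  rw [ENNReal.mul_lt_top_iff]
  constructor
  · rintro (h | h | h)
    · exact h.2
    · exact absurd h hc
    · rw [sqNorm, h]; exact ENNReal.zero_lt_top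
  · exact fun h => Or.inl ⟨ENNReal.ofReal_lt_top, h⟩

/-! ### Localisation in time -/

/-- Convolution of the space-time transform with `κ`, which is multiplication by a function of
time when `κ` is the Fourier transform of that function. -/
def timeConv (G : ℤ → ℝ → ℂ) (κ : ℝ → ℂ) (k : ℤ) (ξ : ℝ) : ℂ := ∫ τ, G k τ * κ (ξ - τ)

theorem aestronglyMeasurable_timeConv {G : ℤ → ℝ → ℂ} (hG : ∀ k, AEStronglyMeasurable (G k) volume)
    {κ : ℝ → ℂ} (hκ : Continuous κ) (k : ℤ) :
    AEStronglyMeasurable (timeConv G κ k) volume := by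
  have h : AEStronglyMeasurable (fun p : ℝ × ℝ => G k p.2 * κ (p.1 - p.2))
      (volume.prod volume) :=
    ((hG k).comp_snd).mul (hκ.comp (by fun_prop)).aestronglyMeasurable
  exact h.integral_prod_right'

/-- The `X^{s,β}` norm is stable under localisation in time, by the inequalities of Peetre and
Young. -/
theorem sqNorm_timeConv_lt_top {j : ℕ} {s β : ℝ} {G : ℤ → ℝ → ℂ}
    (hG : ∀ k, AEStronglyMeasurable (G k) volume)
    (h : sqNorm (fun k τ => wt s k * (wt β (τ - (k : ℝ) ^ (2 * j + 1)) * ‖G k τ‖ₑ)) < ⊤)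
    {κ : ℝ → ℂ} (hκ : Continuous κ) (hκβ : ∫⁻ ξ, wt |β| ξ * ‖κ ξ‖ₑ < ⊤) :
    sqNorm (fun k ξ => wt s k *
      (wt β (ξ - (k : ℝ) ^ (2 * j + 1)) * ‖timeConv G κ k ξ‖ₑ)) < ⊤ := by
  set a : ℝ → ℝ≥0∞ := fun ξ => wt |β| ξ * ‖κ ξ‖ₑ
  set m : ℤ → ℝ → ℝ≥0∞ := fun k τ => wt s k * (wt β (τ - (k : ℝ) ^ (2 * j + 1)) * ‖G k τ‖ₑ)
  set C := ENNReal.ofReal (2 ^ |β|)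
  have hC : C ≠ ⊤ := ENNReal.ofReal_ne_top
  have ha : Measurable a := (measurable_wt _).mul hκ.enorm.measurable
  have hm : ∀ k, AEMeasurable (m k) := fun k =>
    (((measurable_wt β).comp (measurable_id.sub_const _)).aemeasurable.mul
      (hG k).enorm).const_mul _
  have hpt : ∀ (k : ℤ) (ξ : ℝ), wt s k * (wt β (ξ - (k : ℝ) ^ (2 * j + 1)) * ‖timeConv G κ k ξ‖ₑ)
      ≤ C * ∫⁻ τ, a (ξ - τ) * m k τ := fun k ξ => by
    calc wt s k * (wt β (ξ - (k : ℝ) ^ (2 * j + 1)) * ‖timeConv G κ k ξ‖ₑ)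
        ≤ wt s k * (wt β (ξ - (k : ℝ) ^ (2 * j + 1)) * ∫⁻ τ, ‖G k τ * κ (ξ - τ)‖ₑ) := by
          gcongr; exact enorm_integral_le_lintegral_enorm _
      _ = ∫⁻ τ, wt s k * (wt β (ξ - (k : ℝ) ^ (2 * j + 1)) * ‖G k τ * κ (ξ - τ)‖ₑ) := by
          rw [lintegral_const_mul' _ _ (wt_ne_top _ _), lintegral_const_mul' _ _ (wt_ne_top _ _)]
      _ ≤ ∫⁻ τ, C * (a (ξ - τ) * m k τ) := by
          refine lintegral_mono fun τ => ?_
          have hp := wt_le_peetre β (ξ - (k : ℝ) ^ (2 * j + 1)) (τ - (k : ℝ) ^ (2 * j + 1))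
          rw [sub_sub_sub_cancel_right] at hp
          rw [enorm_mul]
          calc wt s k * (wt β (ξ - (k : ℝ) ^ (2 * j + 1)) * (‖G k τ‖ₑ * ‖κ (ξ - τ)‖ₑ))
              ≤ wt s k * ((C * wt |β| (ξ - τ) * wt β (τ - (k : ℝ) ^ (2 * j + 1))) *
                  (‖G k τ‖ₑ * ‖κ (ξ - τ)‖ₑ)) := by gcongr
            _ = C * (a (ξ - τ) * m k τ) := by simp only [a, m]; ring
      _ = _ := lintegral_const_mul' _ _ hC
  refine (sqNorm_mono hpt).trans_lt ?_
  rw [sqNorm_const_mul C hC]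
  refine ENNReal.mul_lt_top (ENNReal.pow_lt_top hC.lt_top) ?_
  calc sqNorm (fun k ξ => ∫⁻ τ, a (ξ - τ) * m k τ)
      ≤ ∑' k, (∫⁻ ξ, a ξ) ^ 2 * ∫⁻ τ, m k τ ^ 2 :=
        ENNReal.tsum_le_tsum fun k => lintegral_conv_sq_le volume ha (hm k)
    _ = (∫⁻ ξ, a ξ) ^ 2 * sqNorm m := ENNReal.tsum_mul_left
    _ < ⊤ := ENNReal.mul_lt_top (ENNReal.pow_lt_top hκβ) h

theorem wt_one_le (x : ℝ) : wt 1 x ≤ 1 + ‖x‖ₑ := by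
  rw [wt, Real.rpow_one, ← ofReal_norm, ← ENNReal.ofReal_one,
    ← ENNReal.ofReal_add zero_le_one (norm_nonneg _)]
  exact ENNReal.ofReal_le_ofReal (bracket_le_one_add_abs x)

/-- A family whose product with `τ - k^(2j+1)` is a sum of two families in `X^{s,β}` gains one
power of the modulation weight. -/
theorem sqNorm_gain_modulation {j : ℕ} {s β : ℝ} {W H₁ H₂ : ℤ → ℝ → ℂ}
    (hW : ∀ k, AEStronglyMeasurable (W k) volume) (hH : ∀ k, AEStronglyMeasurable (H₁ k) volume)
    (h0 : sqNorm (fun k ξ => wt s k * (wt β (ξ - (k : ℝ) ^ (2 * j + 1)) * ‖W k ξ‖ₑ)) < ⊤)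
    (h1 : sqNorm (fun k ξ => wt s k * (wt β (ξ - (k : ℝ) ^ (2 * j + 1)) * ‖H₁ k ξ‖ₑ)) < ⊤)
    (h2 : sqNorm (fun k ξ => wt s k * (wt β (ξ - (k : ℝ) ^ (2 * j + 1)) * ‖H₂ k ξ‖ₑ)) < ⊤)
    (heq : ∀ (k : ℤ) (ξ : ℝ), Complex.I * (ξ - (k : ℝ) ^ (2 * j + 1) : ℝ) * W k ξ
      = H₁ k ξ + H₂ k ξ) :
    sqNorm (fun k ξ => wt s k * (wt (1 + β) (ξ - (k : ℝ) ^ (2 * j + 1)) * ‖W k ξ‖ₑ)) < ⊤ := by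
  have hmeas : ∀ Z : ℤ → ℝ → ℂ, (∀ k, AEStronglyMeasurable (Z k) volume) → ∀ k : ℤ,
      AEMeasurable (fun ξ => wt s k * (wt β (ξ - (k : ℝ) ^ (2 * j + 1)) * ‖Z k ξ‖ₑ)) :=
    fun Z hZ k => (((measurable_wt β).comp (measurable_id.sub_const _)).aemeasurable.mul
      (hZ k).enorm).const_mul _
  refine lt_of_le_of_lt (sqNorm_mono fun k ξ => ?_)
    (sqNorm_add_lt_top (hmeas W hW) h0 (sqNorm_add_lt_top (hmeas H₁ hH) h1 h2))
  set σ := ξ - (k : ℝ) ^ (2 * j + 1)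
  have hσ : ‖σ‖ₑ * ‖W k ξ‖ₑ ≤ ‖H₁ k ξ‖ₑ + ‖H₂ k ξ‖ₑ := by
    have e : ‖σ‖ₑ * ‖W k ξ‖ₑ = ‖H₁ k ξ + H₂ k ξ‖ₑ := by
      have hI : ‖Complex.I‖ₑ = 1 := by simp [← ofReal_norm]
      have hR : ‖(σ : ℂ)‖ₑ = ‖σ‖ₑ := by rw [← ofReal_norm, Complex.norm_real, ofReal_norm]
      rw [← heq, enorm_mul, enorm_mul, hI, one_mul, hR]
    rw [e]
    exact enorm_add_le _ _
  calc wt s k * (wt (1 + β) σ * ‖W k ξ‖ₑ)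
      = wt s k * (wt β σ * (wt 1 σ * ‖W k ξ‖ₑ)) := by rw [wt_add]; ring
    _ ≤ wt s k * (wt β σ * ((1 + ‖σ‖ₑ) * ‖W k ξ‖ₑ)) := by gcongr; exact wt_one_le σ
    _ = wt s k * (wt β σ * (‖W k ξ‖ₑ + ‖σ‖ₑ * ‖W k ξ‖ₑ)) := by ring
    _ ≤ wt s k * (wt β σ * (‖W k ξ‖ₑ + (‖H₁ k ξ‖ₑ + ‖H₂ k ξ‖ₑ))) := by gcongr
    _ = _ := by ring

/-! ### The resonant frequency -/

theorem enorm_le_tsum_of_hasSum {f : ℤ → ℂ} {a : ℂ} (h : HasSum f a) : ‖a‖ₑ ≤ ∑' k, ‖f k‖ₑ := by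
  rw [← h.tsum_eq]; exact enorm_tsum_le_tsum_enorm

open Classical in
/-- The non-resonant part of `W`, together with the local information `V`, in `H^s`. -/
def controlled (j : ℕ) (s : ℝ) (W V : ℤ → ℝ → ℂ) (k : ℤ) (ξ : ℝ) : ℝ≥0∞ :=
  (if Resonant j k ξ then 0 else wt s k * ‖W k ξ‖ₑ) + wt s k * ‖V k ξ‖ₑ

/-- For each `ξ` at most one coefficient `W_n(ξ)` is resonant. It is recovered by solving
`∑_k X(n-k) W_k = ∑_k X(n-k) V_k` for it, because `X(0) ≠ 0`. -/
theorem wt_mul_enorm_le_controlled {j : ℕ} {s : ℝ} {X : ℤ → ℂ} {W V : ℤ → ℝ → ℂ} {n : ℤ} {ξ : ℝ}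
    (hX0 : X 0 ≠ 0) {S : ℂ} (hW : HasSum (fun k => X (n - k) * W k ξ) S)
    (hV : HasSum (fun k => X (n - k) * V k ξ) S) :
    wt s n * ‖W n ξ‖ₑ ≤ controlled j s W V n ξ + ‖X 0‖ₑ⁻¹ * ENNReal.ofReal (2 ^ |s|) *
      ∑' k : ℤ, (wt |s| (n - k : ℤ) * ‖X (n - k)‖ₑ) * controlled j s W V k ξ := by
  by_cases hn : Resonant j n ξ
  swap
  · refine le_add_right ?_
    rw [controlled, if_neg hn]
    exact le_self_add
  refine le_add_left ?_
  have hdiff := hV.sub (hasSum_ite_sub_hasSum hW n)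
  rw [sub_self, sub_sub_cancel] at hdiff
  have hX : ‖X 0‖ₑ ≠ 0 := by simpa using hX0
  have hterm : ∀ k, wt s n * ‖X (n - k) * V k ξ - (if k = n then 0 else X (n - k) * W k ξ)‖ₑ
      ≤ ENNReal.ofReal (2 ^ |s|) *
        ((wt |s| (n - k : ℤ) * ‖X (n - k)‖ₑ) * controlled j s W V k ξ) := fun k => by
    have hin : ‖X (n - k) * V k ξ - (if k = n then 0 else X (n - k) * W k ξ)‖ₑ * wt s k
        ≤ ‖X (n - k)‖ₑ * controlled j s W V k ξ := by
      by_cases hk : k = n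
      · subst hk
        rw [if_pos rfl, sub_zero, enorm_mul, controlled, mul_assoc, mul_comm ‖V k ξ‖ₑ]
        gcongr
        exact le_add_self
      · have hk' : ¬ Resonant j k ξ := fun h => hk (h.unique hn)
        rw [if_neg hk, controlled, if_neg hk', ← mul_sub, enorm_mul, mul_assoc, ← mul_add,
          mul_comm (wt s k)]
        gcongr
        rw [add_comm]
        exact enorm_sub_le
    have hp := wt_le_peetre s (n : ℝ) (k : ℝ)
    rw [← Int.cast_sub] at hp
    set Z := ‖X (n - k) * V k ξ - (if k = n then 0 else X (n - k) * W k ξ)‖ₑ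
    calc wt s n * Z ≤ ENNReal.ofReal (2 ^ |s|) * wt |s| (n - k : ℤ) * wt s k * Z := by gcongr
      _ = ENNReal.ofReal (2 ^ |s|) * wt |s| (n - k : ℤ) * (Z * wt s k) := by ring
      _ ≤ ENNReal.ofReal (2 ^ |s|) * wt |s| (n - k : ℤ) *
          (‖X (n - k)‖ₑ * controlled j s W V k ξ) := by gcongr
      _ = _ := by ring
  have hfin : ‖X 0‖ₑ * (wt s n * ‖W n ξ‖ₑ) ≤ ENNReal.ofReal (2 ^ |s|) *
      ∑' k : ℤ, (wt |s| (n - k : ℤ) * ‖X (n - k)‖ₑ) * controlled j s W V k ξ := by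
    calc ‖X 0‖ₑ * (wt s n * ‖W n ξ‖ₑ) = wt s n * ‖X 0 * W n ξ‖ₑ := by
          rw [enorm_mul]; ring
      _ ≤ wt s n * ∑' k, ‖X (n - k) * V k ξ - (if k = n then 0 else X (n - k) * W k ξ)‖ₑ := by
          gcongr; exact enorm_le_tsum_of_hasSum hdiff
      _ ≤ _ := by
          rw [← ENNReal.tsum_mul_left, ← ENNReal.tsum_mul_left]
          exact ENNReal.tsum_le_tsum hterm
  rw [mul_assoc]
  calc wt s n * ‖W n ξ‖ₑ = ‖X 0‖ₑ⁻¹ * (‖X 0‖ₑ * (wt s n * ‖W n ξ‖ₑ)) := by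
        rw [← mul_assoc, ENNReal.inv_mul_cancel hX enorm_ne_top, one_mul]
    _ ≤ _ := by gcongr

theorem aemeasurable_controlled {j : ℕ} {s : ℝ} {W V : ℤ → ℝ → ℂ}
    (hW : ∀ k, AEStronglyMeasurable (W k) volume) (hV : ∀ k, AEStronglyMeasurable (V k) volume)
    (k : ℤ) : AEMeasurable (controlled j s W V k) := by
  classical
  refine AEMeasurable.add ?_ ((hV k).enorm.const_mul _)
  have h := ((hW k).enorm.const_mul (wt s k)).indicator (measurableSet_resonant j k).compl
  refine h.congr (Filter.Eventually.of_forall fun ξ => ?_)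
  by_cases hr : Resonant j k ξ <;> simp [hr, indicator]

open Classical in
/-- A family whose nonresonant part is in `H^s`, and whose discrete convolution with the
coefficients `X` of a cutoff agrees with that of a family in `H^s`, is itself in `H^s`. -/
theorem sqNorm_lt_top_of_local {j : ℕ} {s : ℝ} {X : ℤ → ℂ} {W V : ℤ → ℝ → ℂ}
    (hW : ∀ k, AEStronglyMeasurable (W k) volume) (hV : ∀ k, AEStronglyMeasurable (V k) volume)
    (hX0 : X 0 ≠ 0) (hXs : ∑' m : ℤ, wt |s| m * ‖X m‖ₑ < ⊤)
    (hVs : sqNorm (fun k ξ => wt s k * ‖V k ξ‖ₑ) < ⊤)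
    (hWs : sqNorm (fun k ξ => if Resonant j k ξ then 0 else wt s k * ‖W k ξ‖ₑ) < ⊤)
    (hloc : ∀ n ξ, ∃ S, HasSum (fun k => X (n - k) * W k ξ) S ∧
      HasSum (fun k => X (n - k) * V k ξ) S) :
    sqNorm (fun k ξ => wt s k * ‖W k ξ‖ₑ) < ⊤ := by
  set m := controlled j s W V
  have hm : ∀ k, AEMeasurable (m k) := aemeasurable_controlled hW hV
  have hmfin : sqNorm m < ⊤ := by
    have h := sqNorm_add_lt_top (fun k => (hV k).enorm.const_mul (wt s k)) hVs hWs
    refine lt_of_le_of_lt (sqNorm_mono fun k ξ => ?_) h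
    rw [add_comm]
    exact le_rfl
  set a : ℤ → ℝ≥0∞ := fun l => wt |s| l * ‖X l‖ₑ
  set C := ‖X 0‖ₑ⁻¹ * ENNReal.ofReal (2 ^ |s|)
  have hC : C ≠ ⊤ := ENNReal.mul_ne_top (ENNReal.inv_ne_top.2 (by simpa using hX0))
    ENNReal.ofReal_ne_top
  have hconv : sqNorm (fun n ξ => ∑' k, a (n - k) * m k ξ) ≤ (∑' l, a l) ^ 2 * sqNorm m := by
    rw [sqNorm_eq_lintegral_tsum (fun n => AEMeasurable.tsum fun k => (hm k).const_mul _),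
      sqNorm_eq_lintegral_tsum hm,
      ← lintegral_const_mul' _ _ (ENNReal.pow_ne_top hXs.ne)]
    exact lintegral_mono fun ξ => tsum_conv_sq_le a fun k => m k ξ
  have hconv' : sqNorm (fun n ξ => C * ∑' k, a (n - k) * m k ξ) < ⊤ := by
    rw [sqNorm_const_mul C hC]
    exact ENNReal.mul_lt_top (ENNReal.pow_lt_top hC.lt_top)
      (hconv.trans_lt (ENNReal.mul_lt_top (ENNReal.pow_lt_top hXs) hmfin))
  refine lt_of_le_of_lt (sqNorm_mono fun n ξ => ?_) (sqNorm_add_lt_top hm hmfin hconv')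
  obtain ⟨S, h1, h2⟩ := hloc n ξ
  exact wt_mul_enorm_le_controlled hX0 h1 h2

open Classical in
/-- Away from resonance, the modulation weight yields `ρ` derivatives. -/
theorem sqNorm_nonresonant_lt_top {j : ℕ} {r c ρ : ℝ} (hc : 0 ≤ c) (hρ : ρ ≤ 2 * j * c)
    {W : ℤ → ℝ → ℂ}
    (h : sqNorm (fun k ξ => wt r k * (wt c (ξ - (k : ℝ) ^ (2 * j + 1)) * ‖W k ξ‖ₑ)) < ⊤) :
    sqNorm (fun k ξ => if Resonant j k ξ then 0 else wt (r + ρ) k * ‖W k ξ‖ₑ) < ⊤ := by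
  set C := ENNReal.ofReal ((2 ^ (j + 1)) ^ c)
  have hC : C ≠ ⊤ := ENNReal.ofReal_ne_top
  refine lt_of_le_of_lt (sqNorm_mono (N := fun k ξ => C *
    (wt r k * (wt c (ξ - (k : ℝ) ^ (2 * j + 1)) * ‖W k ξ‖ₑ))) fun k ξ => ?_) ?_
  · split_ifs with hr
    · exact zero_le
    · rw [wt_add]
      calc wt r k * wt ρ k * ‖W k ξ‖ₑ
          ≤ wt r k * (C * wt c (ξ - (k : ℝ) ^ (2 * j + 1))) * ‖W k ξ‖ₑ := by
            gcongr; exact wt_le_of_not_resonant hc hρ hr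
        _ = _ := by ring
  · rw [sqNorm_const_mul C hC]
    exact ENNReal.mul_lt_top (ENNReal.pow_lt_top hC.lt_top) h

/-! ### Pairing with product test functions -/

theorem testFn_mono {Ω Ω' : Set (ℝ × Torus)} (h : Ω ⊆ Ω') {φ : ℝ × Torus → ℂ}
    (hφ : φ ∈ testFn Ω) : φ ∈ testFn Ω' :=
  ⟨hφ.1, hφ.2.1, hφ.2.2.trans h⟩

theorem tens_modulate_mem {ψ : ℝ → ℂ} {χ : Torus → ℂ} {I : Set ℝ} {U : Set Torus}
    (hψ : ContDiff ℝ (⊤ : ℕ∞) ψ) (hψc : HasCompactSupport ψ) (hψI : tsupport ψ ⊆ I)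
    (hχ : ContDiff ℝ (⊤ : ℕ∞) fun x : ℝ => χ (x : Torus)) (hχU : tsupport χ ⊆ U)
    (ξ : ℝ) (n : ℤ) :
    tens (modulate ψ ξ) (fun x => χ x * fourier (-n) x) ∈ testFn (I ×ˢ U) :=
  tens_mem (contDiff_modulate hψ ξ) (hasCompactSupport_modulate hψc ξ)
    ((tsupport_modulate ψ ξ).trans_subset hψI) (hχ.mul (contDiff_fourier (-n)))
    ((tsupport_mul_subset_left (f := χ)).trans hχU)

/-- The pairing of `u` with `ψ(t) e^{-itξ} χ(x) e^{-inx}`, in terms of the transform of `ψ u`. -/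
theorem hasSum_pairing_transform {G : ℤ → ℝ → ℂ} {g : distr (univ : Set (ℝ × Torus))}
    (hg : ∀ φ : testFn (univ : Set (ℝ × Torus)),
      HasSum (fun k : ℤ => ∫ τ : ℝ, G k τ * stFourier φ.1 (-τ) (-k)) (g.1 φ))
    {I : Set ℝ} {u : distr (I ×ˢ (univ : Set Torus))} (hu : EqOn u g (I ×ˢ univ))
    {ψ : ℝ → ℂ} {χ : Torus → ℂ} {ξ : ℝ} {n : ℤ}
    (h : tens (modulate ψ ξ) (fun x => χ x * fourier (-n) x) ∈ testFn (I ×ˢ (univ : Set Torus))) :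
    HasSum (fun k => torusCoeff χ (n - k) * timeConv G (fourierInt ψ) k ξ) (u.1 ⟨_, h⟩) := by
  have h2 := testFn_mono (subset_univ _) h
  rw [hu _ h h2 h]
  have hs := hg ⟨_, h2⟩
  simp only [stFourier_modulate] at hs
  convert hs using 2 with k
  rw [timeConv, ← integral_const_mul]
  refine integral_congr_ae (Filter.Eventually.of_forall fun τ => ?_)
  simp only
  ring

theorem pairing_transform_eq {G : ℤ → ℝ → ℂ} {g : distr (univ : Set (ℝ × Torus))}
    (hg : ∀ φ : testFn (univ : Set (ℝ × Torus)),
      HasSum (fun k : ℤ => ∫ τ : ℝ, G k τ * stFourier φ.1 (-τ) (-k)) (g.1 φ))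
    {I : Set ℝ} {u : distr (I ×ˢ (univ : Set Torus))} (hu : EqOn u g (I ×ˢ univ))
    {ψ : ℝ → ℂ} {ξ : ℝ} {n : ℤ}
    (h : tens (modulate ψ ξ) (fourier (-n)) ∈ testFn (I ×ˢ (univ : Set Torus))) :
    u.1 ⟨_, h⟩ = timeConv G (fourierInt ψ) n ξ := by
  have h1 : tens (modulate ψ ξ) (fun x => (1 : ℂ) * fourier (-n) x)
      ∈ testFn (I ×ˢ (univ : Set Torus)) := by simpa only [one_mul] using h
  have hs := hasSum_pairing_transform hg hu (χ := fun _ => 1) h1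
  simp only [one_mul, torusCoeff_one] at hs
  refine hs.unique ?_
  have := hasSum_single (f := fun k => (if n - k = 0 then (1 : ℂ) else 0) *
    timeConv G (fourierInt ψ) k ξ) n fun k hk => by
      rw [if_neg (sub_ne_zero.2 (Ne.symm hk)), zero_mul]
  simpa using this

/-- The space-time transform of `ψ v` for `v = ∑_k c_k(t) e^{ikx}` on `I × 𝕋`. The factor `2π`
makes it comparable with `timeConv`: by the normalisation in `Xsb`, the coefficient of `e^{ikx}` is
`c_k(t) = (2π)⁻¹ ∫ G_k(τ) e^{itτ} dτ`. -/
def localTransform (c : ℤ → ℝ → ℂ) (I : Set ℝ) (ψ : ℝ → ℂ) (k : ℤ) (ξ : ℝ) : ℂ :=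
  (2 * Real.pi : ℝ) * fourierInt (I.indicator fun t => c k t * ψ t) ξ

theorem hasSum_pairing_local {I : Set ℝ} (hI : MeasurableSet I) {c : ℤ → ℝ → ℂ}
    {v : distr (I ×ˢ (univ : Set Torus))}
    (hv : ∀ φ : testFn (I ×ˢ (univ : Set Torus)),
      HasSum (fun k : ℤ => ∫ t in I, ∫ x : Torus, c k t * fourier k x * φ.1 (t, x)) (v.1 φ))
    {ψ : ℝ → ℂ} {χ : Torus → ℂ} {ξ : ℝ} {n : ℤ}
    (h : tens (modulate ψ ξ) (fun x => χ x * fourier (-n) x) ∈ testFn (I ×ˢ (univ : Set Torus))) :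
    HasSum (fun k => torusCoeff χ (n - k) * localTransform c I ψ k ξ) (v.1 ⟨_, h⟩) := by
  have hs := hv ⟨_, h⟩
  convert hs using 2 with k
  have hpi : ((2 * Real.pi : ℝ) : ℂ) ≠ 0 := by exact_mod_cast Real.two_pi_pos.ne'
  have e : ∀ t, ∫ x : Torus, c k t * fourier k x *
      tens (modulate ψ ξ) (fun x => χ x * fourier (-n) x) (t, x)
      = Complex.exp (-(Complex.I * (t * ξ : ℝ))) * (c k t * ψ t) *
        ((2 * Real.pi : ℝ) * torusCoeff χ (n - k)) := fun t => by
    rw [torusCoeff, mul_inv_cancel_left₀ hpi, ← integral_const_mul]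
    refine integral_congr_ae (Filter.Eventually.of_forall fun x => ?_)
    simp only [tens, modulate]
    rw [neg_sub, sub_eq_add_neg, fourier_add]
    ring
  simp only [e]
  rw [integral_mul_const, localTransform, fourierInt, ← integral_indicator hI]
  have e2 : ∀ t, Complex.exp (-(Complex.I * (t * ξ : ℝ))) * I.indicator (fun t => c k t * ψ t) t
      = I.indicator (fun t => Complex.exp (-(Complex.I * (t * ξ : ℝ))) * (c k t * ψ t)) t :=
    fun t => by by_cases ht : t ∈ I <;> simp [ht]
  simp only [e2]
  ring

theorem memLp_two_of_lintegral_lt_top {α : Type*} [MeasurableSpace α] {μ : Measure α} {h : α → ℂ}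
    (hm : AEStronglyMeasurable h μ) (hfin : ∫⁻ x, ‖h x‖ₑ ^ 2 ∂μ < ⊤) : MemLp h 2 μ := by
  refine ⟨hm, ?_⟩
  rw [← eLpNorm_two_sq] at hfin
  exact (ENNReal.pow_lt_top_iff.1 hfin).resolve_right (by norm_num)

/-- By Plancherel's theorem the transform of `ψ v` inherits the `L²H^s` bound of `v`. -/
theorem localTransform_bound {a b s : ℝ} {c : ℤ → ℝ → ℂ}
    (hc : ∀ k, AEStronglyMeasurable (c k) (volume.restrict (Ioo a b)))
    (hfin : (∫⁻ t in Ioo a b, ∑' k : ℤ,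
      ENNReal.ofReal (bracket (k : ℝ) ^ (2 * s) * ‖c k t‖ ^ 2)) < ⊤)
    {ψ : ℝ → ℂ} (hψ : Continuous ψ) (hψ1 : ∀ t, ‖ψ t‖ ≤ 1) :
    (∀ k, AEStronglyMeasurable (localTransform c (Ioo a b) ψ k) volume) ∧
      sqNorm (fun k ξ => wt s k * ‖localTransform c (Ioo a b) ψ k ξ‖ₑ) < ⊤ := by
  have e : ∀ (k : ℤ) (t : ℝ), ENNReal.ofReal (bracket (k : ℝ) ^ (2 * s) * ‖c k t‖ ^ 2)
      = wt s k ^ 2 * ‖c k t‖ₑ ^ 2 := fun k t => by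
    rw [wt_sq, wt, ← ofReal_norm, ← ENNReal.ofReal_pow (norm_nonneg _),
      ENNReal.ofReal_mul (Real.rpow_nonneg (bracket_pos _).le _)]
  simp only [e] at hfin
  rw [lintegral_tsum fun k => ((hc k).enorm.pow_const 2).const_mul _] at hfin
  have hwt : ∀ k : ℤ, wt s k ^ 2 ≠ ⊤ := fun k => ENNReal.pow_ne_top (wt_ne_top _ _)
  simp only [lintegral_const_mul' _ _ (hwt _)] at hfin
  have hck : ∀ k, ∫⁻ t in Ioo a b, ‖c k t‖ₑ ^ 2 < ⊤ := fun k => by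
    have h1 := (ENNReal.le_tsum k).trans_lt hfin
    refine (ENNReal.mul_lt_top_iff.1 h1).elim (·.2) fun h => h.elim (fun h0 => ?_) fun h0 => ?_
    · exact absurd h0 (pow_ne_zero 2 (wt_ne_zero _ _))
    · rw [h0]; exact ENNReal.zero_lt_top
  have hle : ∀ k t, ‖c k t * ψ t‖ₑ ≤ ‖c k t‖ₑ := fun k t => by
    rw [enorm_mul]
    have : ‖ψ t‖ₑ ≤ 1 := by
      rw [← ofReal_norm]; exact ENNReal.ofReal_le_one.2 (hψ1 t)
    exact mul_le_of_le_one_right' this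
  have hL2 : ∀ k, MemLp (fun t => c k t * ψ t) 2 (volume.restrict (Ioo a b)) := fun k =>
    memLp_two_of_lintegral_lt_top ((hc k).mul hψ.aestronglyMeasurable)
      ((lintegral_mono fun t => pow_le_pow_left' (hle k t) 2).trans_lt (hck k))
  have hL2' : ∀ k, MemLp ((Ioo a b).indicator fun t => c k t * ψ t) 2 := fun k =>
    (memLp_indicator_iff_restrict measurableSet_Ioo).2 (hL2 k)
  have hL1' : ∀ k, Integrable ((Ioo a b).indicator fun t => c k t * ψ t) := fun k =>
    (integrable_indicator_iff measurableSet_Ioo).2 ((hL2 k).integrable (by norm_num))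
  refine ⟨fun k => ?_, ?_⟩
  · exact (continuous_const.mul (continuous_fourierInt (hL1' k))).aestronglyMeasurable
  · set C : ℝ≥0∞ := ‖((2 * Real.pi : ℝ) : ℂ)‖ₑ
    have hC : C ≠ ⊤ := enorm_ne_top
    have hsq : ∀ k : ℤ,
        ∫⁻ ξ, (wt s k * ‖fourierInt ((Ioo a b).indicator fun t => c k t * ψ t) ξ‖ₑ) ^ 2
        ≤ ENNReal.ofReal (2 * Real.pi) * (wt s k ^ 2 * ∫⁻ t in Ioo a b, ‖c k t‖ₑ ^ 2) := fun k => by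
      simp only [mul_pow]
      rw [lintegral_const_mul' _ _ (hwt k), lintegral_fourierInt_sq (hL1' k) (hL2' k),
        ← mul_assoc, mul_comm (wt s k ^ 2), mul_assoc]
      have hmono : ∫⁻ t, ‖(Ioo a b).indicator (fun t => c k t * ψ t) t‖ₑ ^ 2
          ≤ ∫⁻ t in Ioo a b, ‖c k t‖ₑ ^ 2 := by
        rw [← lintegral_indicator measurableSet_Ioo]
        refine lintegral_mono fun t => ?_
        by_cases ht : t ∈ Ioo a b
        · simp only [indicator_of_mem ht]; exact pow_le_pow_left' (hle k t) 2
        · simp [indicator_of_notMem ht]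
      gcongr
    refine lt_of_le_of_lt (sqNorm_mono (N := fun k ξ => C * (wt s k *
      ‖fourierInt ((Ioo a b).indicator fun t => c k t * ψ t) ξ‖ₑ)) fun k ξ => ?_) ?_
    · rw [localTransform, enorm_mul, mul_left_comm]
    · rw [sqNorm_const_mul C hC]
      refine ENNReal.mul_lt_top (ENNReal.pow_lt_top hC.lt_top) ?_
      refine (ENNReal.tsum_le_tsum hsq).trans_lt ?_
      rw [ENNReal.tsum_mul_left]
      exact ENNReal.mul_lt_top ENNReal.ofReal_lt_top hfin

/-! ### Fourier coefficients of a test function in space -/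

/-- The coefficient `∫_𝕋 e^{ikx} φ(t, x) dx` of a test function, as a function of `t`. -/
def partialCoeff (φ : ℝ × Torus → ℂ) (k : ℤ) (t : ℝ) : ℂ := ∫ x : Torus, fourier k x * φ (t, x)

theorem continuous_of_mem_testFn {Ω : Set (ℝ × Torus)} {φ : ℝ × Torus → ℂ} (h : φ ∈ testFn Ω) :
    Continuous φ := by
  have hq : IsOpenQuotientMap (Prod.map (id : ℝ → ℝ) ((↑) : ℝ → Torus)) :=
    IsOpenQuotientMap.id.prodMap QuotientAddGroup.isOpenQuotientMap_mk
  exact hq.isQuotientMap.continuous_iff.2 h.1.continuous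

theorem continuous_partialCoeff {Ω : Set (ℝ × Torus)} {φ : ℝ × Torus → ℂ} (h : φ ∈ testFn Ω)
    (k : ℤ) : Continuous (partialCoeff φ k) := by
  have hφ := continuous_of_mem_testFn h
  have := continuous_parametric_integral_of_continuous (μ := (volume : Measure Torus))
    (f := fun t x => fourier k x * φ (t, x))
    (((map_continuous (fourier k)).comp continuous_snd).mul hφ) isCompact_univ
  simp only [Measure.restrict_univ] at this
  exact this

theorem partialCoeff_eq_zero {I : Set ℝ} {φ : ℝ × Torus → ℂ}
    (h : φ ∈ testFn (I ×ˢ (univ : Set Torus))) (k : ℤ) {t : ℝ} (ht : t ∉ I) :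
    partialCoeff φ k t = 0 := by
  have e : ∀ x : Torus, φ (t, x) = 0 := fun x => image_eq_zero_of_notMem_tsupport fun hm =>
    ht (h.2.2 hm).1
  simp [partialCoeff, e]

theorem hasCompactSupport_partialCoeff {Ω : Set (ℝ × Torus)} {φ : ℝ × Torus → ℂ}
    (h : φ ∈ testFn Ω) (k : ℤ) : HasCompactSupport (partialCoeff φ k) := by
  refine HasCompactSupport.intro (h.2.1.image continuous_fst) fun t ht => ?_
  have e : ∀ x : Torus, φ (t, x) = 0 := fun x => image_eq_zero_of_notMem_tsupport fun hm =>
    ht ⟨_, hm, rfl⟩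
  simp [partialCoeff, e]

theorem stFourier_neg_eq (φ : ℝ × Torus → ℂ) (τ : ℝ) (k : ℤ) :
    stFourier φ τ (-k) = ((2 * Real.pi : ℝ) : ℂ)⁻¹ * fourierInt (partialCoeff φ k) τ := by
  rw [stFourier, fourierInt]
  congr 2
  funext t
  rw [partialCoeff, ← integral_const_mul, neg_neg]
  refine integral_congr_ae (Filter.Eventually.of_forall fun x => ?_)
  simp only
  ring

/-! ### Restriction and regularity from the transform -/

/-- The restriction of a distribution to a smaller set. -/
def restrictDistr {Ω Ω' : Set (ℝ × Torus)} (h : Ω' ⊆ Ω) (u : distr Ω) : distr Ω' :=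
  ⟨{ toFun := fun φ => u.1 ⟨φ.1, testFn_mono h φ.2⟩
     map_add' := fun φ ψ => u.1.map_add ⟨φ.1, testFn_mono h φ.2⟩ ⟨ψ.1, testFn_mono h ψ.2⟩
     map_smul' := fun c φ => u.1.map_smul c ⟨φ.1, testFn_mono h φ.2⟩ }, fun K hK hKΩ => by
    obtain ⟨C, N, hb⟩ := u.2 K hK (hKΩ.trans h)
    exact ⟨C, N, fun φ hφ M hM => hb ⟨φ.1, testFn_mono h φ.2⟩ hφ M hM⟩⟩

/-- If the transform of `ψ u` has finite norm in `L²H^s`, then so does `u` where `ψ = 1`. -/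
theorem restrictDistr_mem_L2Hs {G : ℤ → ℝ → ℂ} {g : distr (univ : Set (ℝ × Torus))}
    (hG : ∀ k, MemLp (G k) 2)
    (hg : ∀ φ : testFn (univ : Set (ℝ × Torus)),
      HasSum (fun k : ℤ => ∫ τ : ℝ, G k τ * stFourier φ.1 (-τ) (-k)) (g.1 φ))
    {I : Set ℝ} {u : distr (I ×ˢ (univ : Set Torus))} (hu : EqOn u g (I ×ˢ univ))
    {ψ : ℝ → ℂ} (hψ : Continuous ψ) (hψc : HasCompactSupport ψ) {a b s : ℝ}
    (hψ1 : ∀ t ∈ Ioo a b, ψ t = 1)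
    (hfin : sqNorm (fun k ξ => wt s k * ‖timeConv G (fourierInt ψ) k ξ‖ₑ) < ⊤)
    (hsub : Ioo a b ×ˢ (univ : Set Torus) ⊆ I ×ˢ univ) :
    restrictDistr hsub u ∈ L2Hs (Ioo a b) s := by
  choose γ hγ hdual using fun k => exists_dual_fourierInt (hG k)
  have hψ2 : ∀ ξ, MemLp (modulate ψ ξ) 2 := fun ξ =>
    Continuous.memLp_of_hasCompactSupport (by unfold modulate; fun_prop)
      (hasCompactSupport_modulate hψc ξ)
  have hψ1' : ∀ ξ, Integrable (modulate ψ ξ) := fun ξ =>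
    Continuous.integrable_of_hasCompactSupport (by unfold modulate; fun_prop)
      (hasCompactSupport_modulate hψc ξ)
  have hψtop : MemLp ψ ⊤ := hψ.memLp_of_hasCompactSupport hψc
  have hψL2 : MemLp ψ 2 := hψ.memLp_of_hasCompactSupport hψc
  -- The cut-off coefficient `ψ γ_k` has the transform that is assumed to be bounded.
  have htr : ∀ k ξ, fourierInt (fun t => γ k t * ψ t) ξ = timeConv G (fourierInt ψ) k ξ :=
    fun k ξ => by
      have h1 := hdual k (modulate ψ ξ) (hψ1' ξ) (hψ2 ξ)
      simp only [fourierInt_modulate] at h1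
      refine Eq.trans ?_ h1
      refine integral_congr_ae (Filter.Eventually.of_forall fun t => ?_)
      simp only [modulate]
      ring
  have hplan : ∀ k, ∫⁻ t in Ioo a b, ‖γ k t‖ₑ ^ 2
      ≤ (ENNReal.ofReal (2 * Real.pi))⁻¹ * ∫⁻ ξ, ‖timeConv G (fourierInt ψ) k ξ‖ₑ ^ 2 := fun k => by
    have hint : Integrable fun t => γ k t * ψ t := (hγ k).integrable_mul hψL2
    have hmem : MemLp (fun t => γ k t * ψ t) 2 := hψtop.mul (hγ k)
    simp only [← htr]
    rw [lintegral_fourierInt_sq hint hmem, ← mul_assoc,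
      ENNReal.inv_mul_cancel (by simpa using Real.pi_pos) ENNReal.ofReal_ne_top, one_mul]
    rw [← lintegral_indicator measurableSet_Ioo]
    refine lintegral_mono fun t => ?_
    by_cases ht : t ∈ Ioo a b
    · simp only [indicator_of_mem ht, hψ1 t ht, mul_one]; exact le_rfl
    · simp [indicator_of_notMem ht]
  refine ⟨fun k t => ((2 * Real.pi : ℝ) : ℂ)⁻¹ * γ k t,
    fun k => ((hγ k).1.const_mul _).restrict, ?_, fun φ => ?_⟩
  · set C : ℝ≥0∞ := ‖((2 * Real.pi : ℝ) : ℂ)⁻¹‖ₑ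
    have hC : C ≠ ⊤ := enorm_ne_top
    have e : ∀ (k : ℤ) (t : ℝ), ENNReal.ofReal (bracket (k : ℝ) ^ (2 * s) *
        ‖((2 * Real.pi : ℝ) : ℂ)⁻¹ * γ k t‖ ^ 2) = (C ^ 2 * wt s k ^ 2) * ‖γ k t‖ₑ ^ 2 :=
        fun k t => by
      rw [ENNReal.ofReal_mul (Real.rpow_nonneg (bracket_pos _).le _),
        ENNReal.ofReal_pow (norm_nonneg _), ofReal_norm, enorm_mul, wt_sq, wt]
      ring
    have hw : ∀ k : ℤ, C ^ 2 * wt s k ^ 2 ≠ ⊤ := fun k =>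
      ENNReal.mul_ne_top (ENNReal.pow_ne_top hC) (ENNReal.pow_ne_top (wt_ne_top _ _))
    simp only [e]
    rw [lintegral_tsum fun k => (((hγ k).1.restrict).enorm.pow_const 2).const_mul _]
    simp only [lintegral_const_mul' _ _ (hw _)]
    have hbound : ∀ k : ℤ, C ^ 2 * wt s k ^ 2 * ∫⁻ t in Ioo a b, ‖γ k t‖ₑ ^ 2
        ≤ C ^ 2 * (ENNReal.ofReal (2 * Real.pi))⁻¹ *
          ∫⁻ ξ, (wt s k * ‖timeConv G (fourierInt ψ) k ξ‖ₑ) ^ 2 := fun k => by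
      simp only [mul_pow]
      rw [lintegral_const_mul' _ _ (ENNReal.pow_ne_top (wt_ne_top _ _))]
      calc C ^ 2 * wt s k ^ 2 * ∫⁻ t in Ioo a b, ‖γ k t‖ₑ ^ 2
          ≤ C ^ 2 * wt s k ^ 2 * ((ENNReal.ofReal (2 * Real.pi))⁻¹ *
            ∫⁻ ξ, ‖timeConv G (fourierInt ψ) k ξ‖ₑ ^ 2) := by gcongr; exact hplan k
        _ = _ := by ring
    refine (ENNReal.tsum_le_tsum hbound).trans_lt ?_
    rw [ENNReal.tsum_mul_left]
    exact ENNReal.mul_lt_top (ENNReal.mul_lt_top (ENNReal.pow_lt_top hC.lt_top)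
      (ENNReal.inv_lt_top.2 (by simpa using Real.pi_pos))) hfin
  · have h2 := testFn_mono hsub φ.2
    have h3 := testFn_mono (subset_univ _) h2
    have hs := hg ⟨φ.1, h3⟩
    have hval : (restrictDistr hsub u).1 φ = g.1 ⟨φ.1, h3⟩ := hu φ.1 h2 h3 h2
    rw [hval]
    convert hs using 2 with k
    have hpc := continuous_partialCoeff φ.2 k
    have hps := hasCompactSupport_partialCoeff φ.2 k
    have h4 := hdual k (partialCoeff φ.1 k) (hpc.integrable_of_hasCompactSupport hps)
      (hpc.memLp_of_hasCompactSupport hps)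
    have e1 : ∀ t, ∫ x : Torus, ((2 * Real.pi : ℝ) : ℂ)⁻¹ * γ k t * fourier k x * φ.1 (t, x)
        = ((2 * Real.pi : ℝ) : ℂ)⁻¹ * (γ k t * partialCoeff φ.1 k t) := fun t => by
      rw [partialCoeff, ← integral_const_mul, ← integral_const_mul]
      refine integral_congr_ae (Filter.Eventually.of_forall fun x => ?_)
      simp only
      ring
    simp only [e1, stFourier_neg_eq]
    rw [integral_const_mul, setIntegral_eq_integral_of_forall_compl_eq_zero fun t ht => by
      rw [partialCoeff_eq_zero φ.2 k ht, mul_zero], h4, ← integral_const_mul]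
    refine integral_congr_ae (Filter.Eventually.of_forall fun τ => ?_)
    simp only
    ring

/-- A smooth cutoff in time that equals `1` on `(a, b)`. -/
theorem exists_time_cutoff {a b ε : ℝ} (hab : a < b) (hε : 0 < ε) :
    ∃ ψ : ℝ → ℂ, ContDiff ℝ (⊤ : ℕ∞) ψ ∧ HasCompactSupport ψ ∧
      tsupport ψ ⊆ Ioo (a - ε) (b + ε) ∧ (∀ t ∈ Ioo a b, ψ t = 1) ∧ ∀ t, ‖ψ t‖ ≤ 1 := by
  let B : ContDiffBump ((a + b) / 2) :=
    ⟨(b - a) / 2, (b - a) / 2 + ε / 2, by linarith, by linarith⟩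
  have hsupp : tsupport (fun t => (B t : ℂ)) ⊆ Metric.closedBall ((a + b) / 2) B.rOut := by
    rw [← B.tsupport_eq]
    refine closure_mono fun t ht => ?_
    simpa using ht
  refine ⟨fun t => (B t : ℂ), Complex.ofRealCLM.contDiff.comp B.contDiff,
    B.hasCompactSupport.comp_left Complex.ofReal_zero, hsupp.trans fun t ht => ?_,
    fun t ht => ?_, fun t => ?_⟩
  · rw [Real.closedBall_eq_Icc] at ht
    have h1 : (a + b) / 2 - ((b - a) / 2 + ε / 2) ≤ t := ht.1
    have h2 : t ≤ (a + b) / 2 + ((b - a) / 2 + ε / 2) := ht.2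
    exact ⟨by linarith, by linarith⟩
  · simp only
    rw [B.one_of_mem_closedBall, Complex.ofReal_one]
    rw [Real.closedBall_eq_Icc]
    change (a + b) / 2 - (b - a) / 2 ≤ t ∧ t ≤ (a + b) / 2 + (b - a) / 2
    exact ⟨by linarith [ht.1], by linarith [ht.2]⟩
  · rw [Complex.norm_real, Real.norm_of_nonneg B.nonneg]
    exact B.le_one

end TorusDispersive
end

theorem proposition4p6 (j : ℕ) (hj : 1 ≤ j) (T : ℝ) (hT : 0 < T) (r b : ℝ)
    (hb₀ : 0 ≤ b) (hb₁ : b ≤ 1)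
    (u f : TorusDispersive.distr (Set.Ioo 0 T ×ˢ (Set.univ : Set TorusDispersive.Torus)))
    (hf : f ∈ TorusDispersive.XsbOn j (Set.Ioo 0 T) r (-b))
    (hu : u ∈ TorusDispersive.XsbOn j (Set.Ioo 0 T) r b)
    (heq : TorusDispersive.kdvOp j _ u = f)
    (ω : Set TorusDispersive.Torus) (hω : IsOpen ω) (hω_ne : ω.Nonempty)
    (ρ : ℝ) (hρ₀ : 0 < ρ) (hρ : ρ ≤ min ((j : ℝ) * (1 - b)) (1 / 2))
    (hloc : TorusDispersive.MemL2locHs T (r + ρ) ω u) :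
    TorusDispersive.MemL2locHs T (r + ρ) Set.univ u := by
  open TorusDispersive in
  intro a d ha had hdT
  obtain ⟨g, ⟨G, hGm, hGn, hg⟩, hug⟩ := hu
  obtain ⟨g', ⟨F, hFm, hFn, hg'⟩, hfg'⟩ := hf
  obtain ⟨ε, hε, hεa, hεd⟩ : ∃ ε > 0, 0 < a - ε ∧ d + ε < T :=
    ⟨min (a / 2) ((T - d) / 2), lt_min (by linarith) (by linarith),
      by linarith [min_le_left (a / 2) ((T - d) / 2)],
      by linarith [min_le_right (a / 2) ((T - d) / 2)]⟩
  obtain ⟨ψ, hψ, hψc, hψsupp, hψ1, hψle⟩ := exists_time_cutoff had hε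
  obtain ⟨χ, hχ, hχω, hχ0⟩ := exists_cutoff hω hω_ne
  have hJ : Set.Ioo (a - ε) (d + ε) ⊆ Set.Ioo 0 T := Set.Ioo_subset_Ioo hεa.le hεd.le
  have hψ' : ContDiff ℝ (⊤ : ℕ∞) (deriv ψ) := (contDiff_infty_iff_deriv.1 hψ).2
  have hψ'c : HasCompactSupport (deriv ψ) := hψc.deriv
  have hψint : Integrable ψ := hψ.continuous.integrable_of_hasCompactSupport hψc
  have hψ'int : Integrable (deriv ψ) := hψ'.continuous.integrable_of_hasCompactSupport hψ'c
  have hκ := continuous_fourierInt hψint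
  have hκ' := continuous_fourierInt hψ'int
  have hκβ := lintegral_wt_fourierInt_lt_top hψ hψc |(-b)|
  have hκ'β := lintegral_wt_fourierInt_lt_top hψ' hψ'c |(-b)|
  have hGn0 := xsbNormSq_lt_top_iff.1 hGn
  -- Since `0 ≤ b`, the transform of `u` is also in `X^{r,-b}`, and it is square integrable.
  have hGn' : sqNorm (fun k τ => wt r k * (wt (-b) (τ - (k : ℝ) ^ (2 * j + 1)) * ‖G k τ‖ₑ)) < ⊤ := by
    refine lt_of_le_of_lt (sqNorm_mono fun k τ => ?_) hGn0
    gcongr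
    exact wt_mono (by linarith) _
  have hG2 : ∀ k, MemLp (G k) 2 := fun k => by
    refine memLp_two_of_lintegral_lt_top (hGm k) ?_
    have h1 := (ENNReal.le_tsum k).trans_lt hGn0
    have hw : wt r k ^ 2 ≠ ⊤ := ENNReal.pow_ne_top (wt_ne_top _ _)
    have h2 : wt r k ^ 2 * ∫⁻ τ, ‖G k τ‖ₑ ^ 2 < ⊤ := by
      rw [← lintegral_const_mul' _ _ hw]
      refine lt_of_le_of_lt (lintegral_mono fun τ => ?_) h1
      rw [← mul_pow]
      refine pow_le_pow_left' ?_ 2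
      change wt r k * ‖G k τ‖ₑ ≤ wt r k * (wt b (τ - (k : ℝ) ^ (2 * j + 1)) * ‖G k τ‖ₑ)
      gcongr
      exact le_mul_of_one_le_left' (one_le_wt hb₀ _)
    refine (ENNReal.mul_lt_top_iff.1 h2).elim (·.2) fun h => h.elim (fun h0 => ?_) fun h0 => ?_
    · exact absurd h0 (pow_ne_zero 2 (wt_ne_zero _ _))
    · rw [h0]; exact ENNReal.zero_lt_top
  set W := timeConv G (fourierInt ψ)
  have hW := aestronglyMeasurable_timeConv hGm hκ
  have hmem : ∀ θ : ℝ → ℂ, ContDiff ℝ (⊤ : ℕ∞) θ → HasCompactSupport θ →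
      tsupport θ ⊆ Set.Ioo (a - ε) (d + ε) → ∀ ξ (n : ℤ), tens (modulate θ ξ) (fourier (-n))
        ∈ testFn (Set.Ioo 0 T ×ˢ (Set.univ : Set Torus)) := fun θ hθ hθc hθs ξ n =>
    tens_mem (contDiff_modulate hθ ξ) (hasCompactSupport_modulate hθc ξ)
      ((tsupport_modulate θ ξ).trans_subset (hθs.trans hJ)) (contDiff_fourier (-n))
      (Set.subset_univ _)
  have heqW : ∀ (k : ℤ) (ξ : ℝ), Complex.I * (ξ - (k : ℝ) ^ (2 * j + 1) : ℝ) * W k ξ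
      = timeConv F (fourierInt ψ) k ξ + timeConv G (fourierInt (deriv ψ)) k ξ := fun k ξ => by
    have h1 := hmem ψ hψ hψc hψsupp ξ k
    have h2 := hmem (deriv ψ) hψ' hψ'c ((tsupport_deriv_subset).trans hψsupp) ξ k
    have h3 := kdvOp_tens j u hψ ξ k h1 h2
    rw [heq, pairing_transform_eq hg' hfg', pairing_transform_eq hg hug,
      pairing_transform_eq hg hug] at h3
    rw [h3]
    ring
  have hgain := sqNorm_gain_modulation hW (aestronglyMeasurable_timeConv hFm hκ)
    (sqNorm_timeConv_lt_top hGm hGn' hκ hκβ)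
    (sqNorm_timeConv_lt_top hFm (xsbNormSq_lt_top_iff.1 hFn) hκ hκβ)
    (sqNorm_timeConv_lt_top hGm hGn' hκ' hκ'β) heqW
  -- Only `ρ ≤ 2j(1 - b)` is needed off resonance; it follows since `j(1 - b)` is nonnegative.
  have hρ' : ρ ≤ 2 * j * (1 + -b) := by
    have h1 := hρ.trans (min_le_left _ _)
    have h2 : 0 ≤ (j : ℝ) * (1 - b) := hρ₀.le.trans h1
    linarith
  have hnonres := sqNorm_nonresonant_lt_top (by linarith) hρ' hgain
  obtain ⟨v, ⟨c, hc, hcfin, hv⟩, huv⟩ := hloc (a - ε) (d + ε) hεa (by linarith) hεd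
  obtain ⟨hV, hVs⟩ := localTransform_bound hc hcfin hψ.continuous hψle
  have hfinal := sqNorm_lt_top_of_local hW hV hχ0 (tsum_wt_torusCoeff_lt_top hχ |r + ρ|) hVs hnonres
    fun n ξ => by
      have h0 := tens_modulate_mem hψ hψc hψsupp hχ hχω ξ n
      have h1 := testFn_mono (Set.prod_mono_right (Set.subset_univ ω)) h0
      have h2 := testFn_mono (Set.prod_mono_left hJ) h1
      refine ⟨_, hasSum_pairing_transform hg hug h2, ?_⟩
      rw [huv _ h2 h1 h0]
      exact hasSum_pairing_local measurableSet_Ioo hv h1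
  have hsub : Set.Ioo a d ×ˢ (Set.univ : Set Torus) ⊆ Set.Ioo 0 T ×ˢ Set.univ :=
    Set.prod_mono_left (Set.Ioo_subset_Ioo ha.le hdT.le)
  exact ⟨restrictDistr hsub u, restrictDistr_mem_L2Hs hG2 hg hug hψ.continuous hψc hψ1 hfinal hsub,
    fun φ _ _ _ => rfl⟩
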